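/- **Setting.** Let $\mathcal N$ be a finite set of buses and let $(\mathcal N,\mathcal E)$, $(\mathcal N,\tilde{\mathcal E})$ be connected graphs (power lines, with an arbitrary orientation, and communication lines). Bus $j$ carries a finite set $\mathcal L_j$ of on-off loads; $\tilde{\mathcal L}=\{(l,j): l\in\mathcal L_j\}$ is nonempty. Load $(l,j)$ has magnitude $\bar d_{l,j}>0$, cost $c_{l,j}\ge 0$, desired state $\rho_{l,j}\in\{0,1\}$ and switching state $\sigma_{l,j}\in\{0,1\}$. Let $B_{ij},M_j,A_j,\gamma_j,\kappa_j,\tau_j,\tau_{ij}>0$, $p^L_j\in\mathbb R$. For $x=(\eta,\omega,p^M,p^c,\psi)$, the system $\dot x=f_\sigma(x)$ is $$\dot\eta_{ij}=\omega_i-\omega_j,\ (i,j)\in\mathcal E,\qquad M_j\dot\omega_j=p^M_j-p^L_j-A_j\omega_j-\sum_{l\in\mathcal L_j}\bar d_{l,j}\sigma_{l,j}-\sum_{k:(j,k)\in\mathcal E}B_{jk}\eta_{jk}+\sum_{i:(i,j)\in\mathcal E}B_{ij}\eta_{ij},$$ $$\gamma_j\dot p^M_j=-(p^M_j+\kappa_j\omega_j-\kappa_jp^c_j),\qquad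 \tau_{ij}\dot\psi_{ij}=p^c_i-p^c_j,\ (i,j)\in\tilde{\mathcal E},$$ $$\tau_j\dot p^c_j=-p^M_j+p^L_j+\sum_{l\in\mathcal L_j}\bar d_{l,j}\sigma_{l,j}-\sum_{k:(j,k)\in\tilde{\mathcal E}}\psi_{jk}+\sum_{i:(i,j)\in\tilde{\mathcal E}}\psi_{ij}.$$ An equilibrium is a pair $(x^*,\sigma)$ with $\sigma\in\{0,1\}^{\tilde{\mathcal L}}$ and $f_\sigma(x^*)=0$. The H-OSC problem is to minimize $\sum_j\big[\tfrac12 q_j(p^M_j)^2+\sum_{l\in\mathcal L_j}c_{l,j}\mathbf 1\{\sigma_{l,j}\ne\rho_{l,j}\}\big]$ over $p^M\in\mathbb R^{\mathcal N}$, $\sigma\in\{0,1\}^{\tilde{\mathcal L}}$ subject to $\sum_jp^M_j=\sum_j(p^L_j+\sum_{l\in\mathcal L_j}\bar d_{l,j}\sigma_{l,j})$; a feasible point is $\epsilon$-optimal if its cost is at most the minimum plus $\epsilon$. Put $\ell=\sum_jp^L_j$, $K=\sum_j\kappa_j$, $\beta=\max\bar d_{l,j}$. **Algorithm.** Let $\mathcal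 G$ be the set of all numbers $\pm c_{l,j}/\bar d_{l,j}$. Let $\delta>0$ be smaller than all $\bar d_{l,j}$ and than all distances between distinct elements of $\mathcal G$; $\hat\beta=\beta+\delta$, $\bar\beta=\beta+\delta/2$; $\bar c=c+r$ with $r\in(0,\delta/2)^{\tilde{\mathcal L}}$ such that the values $\bar c_{l,j}/\bar d_{l,j}$ are pairwise distinct; $\mu\in(0,1)$. For a price $p$ let $\hat\sigma_{l,j}[p]=0$ if $p>\bar c_{l,j}/\bar d_{l,j}$, $1$ if $p<-\bar c_{l,j}/\bar d_{l,j}$, and $\rho_{l,j}$ otherwise. Start with $p^c_{min}(0)\le\ell/K$ and $p^c_{max}(0)\ge\frac1K(\ell+\sum\bar d_{l,j})$ (for instance with equalities), where $p^c_{min}(0)=\ell/K$ is allowed only if $\hat\sigma_{l,j}[p]=1$ for some $p>\ell/K$ and some load, and with $\phi(0)=0$. While $\phi=0$, iteration $k=1,2,\dots$ sets $p^c_{set}(k)=\mu p^c_{max}(k-1)+(1-\mu)p^c_{min}(k-1)$; $\hat\sigma(k)=\hat\sigma[p^c_{set}(k)]$; $\hat p^c(k)=\frac1K(\ell+\bar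 d^T\hat\sigma(k))$; $p^c_{min}(k)=p^c_{set}(k)$ if $p^c_{set}(k)<\hat p^c(k)-\bar\beta/K$ and $p^c_{min}(k-1)$ otherwise; $p^c_{max}(k)=p^c_{set}(k)$ if $p^c_{set}(k)>\hat p^c(k)$ and $p^c_{max}(k-1)$ otherwise; $\phi(k)=1$ if $p^c_{max}(k)-p^c_{min}(k)=p^c_{max}(k-1)-p^c_{min}(k-1)$ and $0$ otherwise. Its output $\bar\sigma(k)$ is $\hat\sigma(k)$ if $\phi(k)=1$; if $\phi(k)=0$, $\bar\sigma_{l,j}(k)$ is $1$ if $p^c_{max}(k)<-\bar c_{l,j}/\bar d_{l,j}-\bar\beta/K$, $0$ if $p^c_{min}(k)>\bar c_{l,j}/\bar d_{l,j}+\bar\beta/K$, and $\rho_{l,j}$ otherwise. Iteration $k$ is completed at time $t_k$, $0\le t_1\le t_2\le\dots$; the switching signal $\sigma(t)$ equals an arbitrary $\sigma(0)\in\{0,1\}^{\tilde{\mathcal L}}$ on $[0,t_1)$ and $\bar\sigma(k)$ on $[t_k,t_{k+1})$, the last interval being $[t_{\hat k},\infty)$ for the iteration $\hat k$ at which $\phi=1$.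 A solution is a pair $z=(x,\sigma)$ on $[0,\infty)$ with such a $\sigma$ and a locally absolutely continuous $x$ satisfying $\dot x=f_\sigma(x)$ almost everywhere. **Theorem.** Let $\kappa_j=q_j^{-1}$ for all $j\in\mathcal N$. There is $\delta_0>0$, depending only on the data of the setting, such that for every choice of the parameters of the algorithm as above there is a nonempty set $S$ of equilibria with the following properties. Every solution $z$, from any initial condition and for any completion times $t_k$, satisfies $\operatorname{dist}(z(t),S)\to0$ as $t\to\infty$. Every $(x^*,\sigma^*)\in S$ satisfies $\omega^*=0$ and $p^{c,*}_i=p^{c,*}_j$ for all $i,j\in\mathcal N$. If moreover $\delta\le\delta_0$, then for every $(x^*,\sigma^*)\in S$ the point $(p^{M,*},\sigma^*)$ is $\epsilon$-optimal for the H-OSC problem with $\epsilon=\dfrac{3\hat\beta^2}{2K}$. -/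

import Mathlib

open Filter Topology MeasureTheory

noncomputable section

/-- The data of a power network with on-off loads: `N` is the set of buses and `𝓛 j` the set of
on-off loads at bus `j`, so that `Σ j, 𝓛 j` is the set of all on-off loads. -/
structure PowerSystem (N : Type*) (𝓛 : N → Type*) where
  /-- transmission lines, with an arbitrary orientation -/
  lines : Finset (N × N)
  /-- communication lines -/
  commLines : Finset (N × N)
  lines_oriented : ∀ i j, (i, j) ∈ lines → (j, i) ∉ lines
  lines_connected : (SimpleGraph.fromRel fun i j => (i, j) ∈ lines).Connected
  commLines_connected : (SimpleGraph.fromRel fun i j => (i, j) ∈ commLines).Connected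
  /-- line susceptances -/
  B : lines → ℝ
  B_pos : ∀ e, 0 < B e
  /-- generator inertia -/
  M : N → ℝ
  M_pos : ∀ j, 0 < M j
  /-- damping coefficients -/
  A : N → ℝ
  A_pos : ∀ j, 0 < A j
  /-- generation time constants -/
  γ : N → ℝ
  γ_pos : ∀ j, 0 < γ j
  /-- droop gains -/
  κ : N → ℝ
  κ_pos : ∀ j, 0 < κ j
  /-- power command time constants at the buses -/
  τ : N → ℝ
  τ_pos : ∀ j, 0 < τ j
  /-- power command time constants on the communication lines -/
  τc : commLines → ℝ
  τc_pos : ∀ e, 0 < τc e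
  /-- uncontrollable frequency-independent demand -/
  pL : N → ℝ
  /-- generation cost coefficients -/
  q : N → ℝ
  /-- magnitudes of the on-off loads -/
  d : (Σ j, 𝓛 j) → ℝ
  d_pos : ∀ l, 0 < d l
  /-- cost of an on-off load not being in its desired state -/
  c : (Σ j, 𝓛 j) → ℝ
  c_nonneg : ∀ l, 0 ≤ c l
  /-- desired states of the on-off loads -/
  ρ : (Σ j, 𝓛 j) → ℝ
  ρ_binary : ∀ l, ρ l = 0 ∨ ρ l = 1

/-- A vector of switching states, i.e. a vector with entries in `{0, 1}`. -/
def IsBinary {ι : Type*} (σ : ι → ℝ) : Prop := ∀ l, σ l = 0 ∨ σ l = 1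

/-- `x` is an `ε`-optimal point for minimizing the cost `C` over the feasible set `F`. -/
def IsEpsOptimal {α : Type*} (C : α → ℝ) (F : Set α) (ε : ℝ) (x : α) : Prop :=
  x ∈ F ∧ ∃ m, IsLeast (C '' F) m ∧ C x ≤ m + ε

namespace PowerSystem

variable {N : Type*} [Fintype N] [DecidableEq N] {𝓛 : N → Type*} [∀ j, Fintype (𝓛 j)]

/-- The continuous state `x = (η, ω, pᴹ, pᶜ, ψ)`. -/
abbrev State (P : PowerSystem N 𝓛) : Type _ :=
  (P.lines → ℝ) × (N → ℝ) × (N → ℝ) × (N → ℝ) × (P.commLines → ℝ)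

/-- The full state `z = (x, σ)`; the switching states are recorded as real vectors, which the
definitions below force to be `{0, 1}`-valued. -/
abbrev FullState (P : PowerSystem N 𝓛) : Type _ := P.State × ((Σ j, 𝓛 j) → ℝ)

/-- power angle differences `η` -/
def eta (P : PowerSystem N 𝓛) (x : P.State) : P.lines → ℝ := x.1

/-- frequency deviations `ω` -/
def omega (P : PowerSystem N 𝓛) (x : P.State) : N → ℝ := x.2.1

/-- mechanical power injections `pᴹ` -/
def pM (P : PowerSystem N 𝓛) (x : P.State) : N → ℝ := x.2.2.1

/-- power commands `pᶜ` -/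
def pC (P : PowerSystem N 𝓛) (x : P.State) : N → ℝ := x.2.2.2.1

/-- integrals `ψ` of the power command differences -/
def psi (P : PowerSystem N 𝓛) (x : P.State) : P.commLines → ℝ := x.2.2.2.2

/-- Demand of the on-off loads at bus `j`. -/
def busDemand (P : PowerSystem N 𝓛) (σ : (Σ j, 𝓛 j) → ℝ) (j : N) : ℝ :=
  ∑ l : 𝓛 j, P.d ⟨j, l⟩ * σ ⟨j, l⟩

/-- The vector field `f_σ` of the closed-loop system: swing equations, generation dynamics,
and power command dynamics. -/
def field (P : PowerSystem N 𝓛) (σ : (Σ j, 𝓛 j) → ℝ) (x : P.State) : P.State :=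
  ( fun e => P.omega x e.1.1 - P.omega x e.1.2,
    fun j => (P.pM x j - P.pL j - P.A j * P.omega x j - P.busDemand σ j
        - (∑ e : P.lines with e.1.1 = j, P.B e * P.eta x e)
        + (∑ e : P.lines with e.1.2 = j, P.B e * P.eta x e)) / P.M j,
    fun j => -(P.pM x j + P.κ j * P.omega x j - P.κ j * P.pC x j) / P.γ j,
    fun j => (-P.pM x j + P.pL j + P.busDemand σ j
        - (∑ e : P.commLines with e.1.1 = j, P.psi x e)
        + (∑ e : P.commLines with e.1.2 = j, P.psi x e)) / P.τ j,
    fun e => (P.pC x e.1.1 - P.pC x e.1.2) / P.τc e )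

/-- `z = (x, σ)` is an equilibrium: `σ` is a vector of switching states and `f_σ(x) = 0`. -/
def IsEquilibrium (P : PowerSystem N 𝓛) (z : P.FullState) : Prop :=
  IsBinary z.2 ∧ P.field z.2 z.1 = 0

/-- The cost of the H-OSC problem. -/
def cost (P : PowerSystem N 𝓛) (y : (N → ℝ) × ((Σ j, 𝓛 j) → ℝ)) : ℝ :=
  ∑ j, (1 / 2 * P.q j * y.1 j ^ 2
    + ∑ l : 𝓛 j, if y.2 ⟨j, l⟩ = P.ρ ⟨j, l⟩ then 0 else P.c ⟨j, l⟩)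

/-- The feasible set of the H-OSC problem. -/
def feasible (P : PowerSystem N 𝓛) : Set ((N → ℝ) × ((Σ j, 𝓛 j) → ℝ)) :=
  {y | ∑ j, y.1 j = ∑ j, (P.pL j + P.busDemand y.2 j) ∧ IsBinary y.2}

/-- Aggregate uncontrollable demand `ℓ`. -/
def ell (P : PowerSystem N 𝓛) : ℝ := ∑ j, P.pL j

/-- Aggregate droop `K`. -/
def K (P : PowerSystem N 𝓛) : ℝ := ∑ j, P.κ j

/-- Magnitude `β` of the largest on-off load. -/
def beta (P : PowerSystem N 𝓛) [Nonempty (Σ j, 𝓛 j)] : ℝ :=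
  Finset.univ.sup' Finset.univ_nonempty P.d

/-- The set `𝒢` of the costs per unit demand `c / d` and their negatives. -/
def unitCosts (P : PowerSystem N 𝓛) : Set ℝ :=
  {g | ∃ l, g = P.c l / P.d l ∨ g = -(P.c l / P.d l)}

/-- The parameters chosen by the designer of the switching algorithm. -/
structure AlgParams (P : PowerSystem N 𝓛) where
  /-- the small constant `δ` -/
  δ : ℝ
  /-- the perturbations of the load costs -/
  r : (Σ j, 𝓛 j) → ℝ
  /-- the weight used in the update of the price signal -/
  μ : ℝ
  /-- initial lower bound of the price signal -/
  pmin₀ : ℝ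
  /-- initial upper bound of the price signal -/
  pmax₀ : ℝ

namespace AlgParams

variable {P : PowerSystem N 𝓛}

/-- Perturbed costs `c̄ = c + r`. -/
def cbar (a : P.AlgParams) (l : Σ j, 𝓛 j) : ℝ := P.c l + a.r l

/-- `β̂ = β + δ` -/
def betaHat [Nonempty (Σ j, 𝓛 j)] (a : P.AlgParams) : ℝ := P.beta + a.δ

/-- `β̄ = β + δ / 2` -/
def betaBar [Nonempty (Σ j, 𝓛 j)] (a : P.AlgParams) : ℝ := P.beta + a.δ / 2

open Classical in
/-- The response `σ̂` of the loads to a price signal `p`. -/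
def response (a : P.AlgParams) (p : ℝ) (l : Σ j, 𝓛 j) : ℝ :=
  if p > a.cbar l / P.d l then 0
  else if p < -(a.cbar l / P.d l) then 1
  else P.ρ l

/-- The conditions imposed on the parameters of the algorithm. -/
structure Admissible (a : P.AlgParams) : Prop where
  δ_pos : 0 < a.δ
  δ_lt_d : ∀ l, a.δ < P.d l
  δ_lt_gap : ∀ g ∈ P.unitCosts, ∀ g' ∈ P.unitCosts, g ≠ g' → a.δ < |g - g'|
  r_mem : ∀ l, a.r l ∈ Set.Ioo 0 (a.δ / 2)
  cbar_distinct : Function.Injective fun l => a.cbar l / P.d l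
  μ_mem : a.μ ∈ Set.Ioo (0 : ℝ) 1
  pmin₀_le : a.pmin₀ ≤ P.ell / P.K
  le_pmax₀ : (P.ell + ∑ l, P.d l) / P.K ≤ a.pmax₀
  /-- the initial lower bound may equal `ℓ / K` only if some load is on at a larger price -/
  range_broad : a.pmin₀ < P.ell / P.K ∨ ∃ p > P.ell / P.K, ∃ l, a.response p l = 1

/-- The variables of the algorithm other than its output. -/
structure Vars (P : PowerSystem N 𝓛) where
  pmin : ℝ
  pmax : ℝ
  pset : ℝ
  phat : ℝ
  sigmaHat : (Σ j, 𝓛 j) → ℝ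
  phi : ℕ

/-- Initialization of the algorithm. -/
def init (a : P.AlgParams) : Vars P where
  pmin := a.pmin₀
  pmax := a.pmax₀
  pset := 0
  phat := 0
  sigmaHat := P.ρ
  phi := 0

open Classical in
/-- One pass through the loop of the algorithm. -/
def step [Nonempty (Σ j, 𝓛 j)] (a : P.AlgParams) (v : Vars P) : Vars P :=
  let pset := a.μ * v.pmax + (1 - a.μ) * v.pmin
  let sigmaHat := a.response pset
  let phat := (P.ell + ∑ l, P.d l * sigmaHat l) / P.K
  let pmin := if pset < phat - a.betaBar / P.K then pset else v.pmin
  let pmax := if pset > phat then pset else v.pmax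
  { pmin := pmin
    pmax := pmax
    pset := pset
    phat := phat
    sigmaHat := sigmaHat
    phi := if pmax - pmin = v.pmax - v.pmin then 1 else 0 }

/-- The variables after the `k`th iteration, the stopping rule being disregarded: the algorithm
executes iteration `k ≥ 1` only if `phi` vanishes at all earlier iterations. -/
def vars [Nonempty (Σ j, 𝓛 j)] (a : P.AlgParams) : ℕ → Vars P
  | 0 => a.init
  | k + 1 => a.step (a.vars k)

open Classical in
/-- The output `σ̄(k)` of iteration `k ≥ 1`. -/
def output [Nonempty (Σ j, 𝓛 j)] (a : P.AlgParams) (k : ℕ) (l : Σ j, 𝓛 j) : ℝ :=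
  if (a.vars k).phi = 1 then (a.vars k).sigmaHat l
  else if (a.vars k).pmax < -(a.cbar l / P.d l) - a.betaBar / P.K then 1
  else if (a.vars k).pmin > a.cbar l / P.d l + a.betaBar / P.K then 0
  else P.ρ l

/-- Iteration `k ≥ 1` is executed. -/
def Executed [Nonempty (Σ j, 𝓛 j)] (a : P.AlgParams) (k : ℕ) : Prop :=
  1 ≤ k ∧ ∀ m < k, (a.vars m).phi = 0

/-- `σ` is the switching signal produced by the algorithm when iteration `k ≥ 1` is completed at
time `t k`: it keeps its initial value before `t 1`, equals the output of iteration `k` on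
`[t k, t (k + 1))`, and keeps the output of the final iteration forever. -/
def IsSwitchingSignal [Nonempty (Σ j, 𝓛 j)] (a : P.AlgParams) (t : ℕ → ℝ)
    (σ : ℝ → (Σ j, 𝓛 j) → ℝ) : Prop :=
  IsBinary (σ 0) ∧
  (∀ s, 0 ≤ s → s < t 1 → σ s = σ 0) ∧
  ∀ k, a.Executed k → ∀ s, t k ≤ s → ((a.vars k).phi = 1 ∨ s < t (k + 1)) → σ s = a.output k

end AlgParams

/-- A complete Caratheodory solution, on the time domain `[0, ∞)`, of `ẋ = f_σ(x)` for a given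
switching signal `σ`. -/
def IsCaratheodorySolution (P : PowerSystem N 𝓛) (σ : ℝ → (Σ j, 𝓛 j) → ℝ) (x : ℝ → P.State) :
    Prop :=
  (∀ T, 0 ≤ T → AbsolutelyContinuousOnInterval x 0 T) ∧
  ∀ᵐ s ∂volume.restrict (Set.Ici (0 : ℝ)), HasDerivAt x (P.field (σ s) (x s)) s

/-- A complete solution `z = (x, σ)` of the closed-loop switching system. -/
def IsSolution (P : PowerSystem N 𝓛) [Nonempty (Σ j, 𝓛 j)] (a : P.AlgParams) (t : ℕ → ℝ)
    (z : ℝ → P.FullState) : Prop :=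
  a.IsSwitchingSignal t (fun s => (z s).2) ∧
  P.IsCaratheodorySolution (fun s => (z s).2) (fun s => (z s).1)

end PowerSystem

end

set_option linter.unusedSectionVars false

noncomputable section

/-! The algorithm never reads the state of the network, so the theorem splits into three independent
facts.

Termination (`exists_final`). Each load is on below one threshold price and off above it, so `power`
is a decreasing step function of the price, and the algorithm is a bisection for a price `p` with `p
≤ power p ≤ p + β̄ / K`. If it never stopped, the bracket would shrink to zero while `power` dropped
across it by more than `β / K`. But the thresholds are distinct, so a short bracket contains at most
one of them, and `power` drops by at most `β / K`.

Convergence (`tendsto_infDist_equilibria`). After the last switch the system is affine. Relative to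
an equilibrium, a quadratic energy decays at the rate at which `ω` and `pM` are dissipated.
Barbalat's lemma, applied repeatedly, sends `ω`, `pM`, then `pC`, then the whole velocity to zero.
For a linear map the distance to the kernel is bounded by a multiple of the norm of the image, so
the state approaches the set of equilibria.

Optimality (`isEpsOptimal`). At equilibrium `pM = κ w` with `w = power p`. Lagrangian duality with
multiplier `p` bounds the cost gap by `K (w - p)² / 2`, from the mismatch between price and power,
plus `∑ r`, from the perturbed costs. These are at most `β̂² / (2K)` and `β² / K`. -/

/-! ### Analytic and linear-algebraic preliminaries -/

/-- An absolutely continuous function whose derivative agrees almost everywhere with a continuous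
function is differentiable everywhere in the interior. -/
theorem AbsolutelyContinuousOnInterval.hasDerivAt_of_ae {E : Type*} [NormedAddCommGroup E]
    [NormedSpace ℝ E] [CompleteSpace E] {f g : ℝ → E} {a b : ℝ} (hab : a ≤ b)
    (hf : AbsolutelyContinuousOnInterval f a b) (hg : ContinuousOn g (Set.Icc a b))
    (h : ∀ᵐ s, s ∈ Set.Icc a b → HasDerivAt f (g s) s) {s : ℝ} (hs : s ∈ Set.Ioo a b) :
    HasDerivAt f (g s) s := by
  -- The constant extension of `g` beyond `[a, b]` is continuous on the whole line, so its primitive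
  -- is `C¹`. Subtracting it from `f` leaves an absolutely continuous function with zero derivative
  -- almost everywhere, hence a constant.
  set G : ℝ → E := Set.IccExtend hab ((Set.Icc a b).domRestrict g) with hGdef
  have hGg : ∀ s ∈ Set.Icc a b, G s = g s := fun s hs => by
    rw [hGdef, Set.IccExtend_of_mem hab _ hs]; rfl
  have hG : Continuous G := hg.domRestrict.Icc_extend'
  have hI : ∀ s, HasDerivAt (fun x => ∫ u in a..x, G u) (G s) s := fun s =>
    hG.integral_hasStrictDerivAt a s |>.hasDerivAt
  have hC1 : ContDiff ℝ 1 (fun x => ∫ u in a..x, G u) := by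
    rw [contDiff_one_iff_deriv]
    refine ⟨fun s => (hI s).differentiableAt, ?_⟩
    have : deriv (fun x => ∫ u in a..x, G u) = G := funext fun s => (hI s).deriv
    rwa [this]
  have hd := hf.sub (hC1.contDiffOn.absolutelyContinuousOnInterval (a := a) (b := b))
  obtain ⟨C, hC⟩ := hd.const_of_ae_hasDerivAt_zero (by
    filter_upwards [h] with s hs hmem
    rw [Set.uIcc_of_le hab] at hmem
    have := (hs hmem).sub (hI s)
    rwa [hGg s hmem, sub_self] at this)
  rw [Set.uIcc_of_le hab] at hC
  have h1 : HasDerivAt (fun x => C + ∫ u in a..x, G u) (g s) s := by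
    have := (hI s).const_add C
    rwa [hGg s ⟨hs.1.le, hs.2.le⟩] at this
  refine h1.congr_of_eventuallyEq ?_
  filter_upwards [Icc_mem_nhds hs.1 hs.2] with x hx
  rw [← hC x hx]
  simp

/-- **Barbalat's lemma**: if `f` converges and `f''` is bounded, then `f'` tends to zero. -/
theorem tendsto_deriv_zero_of_tendsto {E : Type*} [NormedAddCommGroup E] [NormedSpace ℝ E]
    {f f' f'' : ℝ → E} {T C : ℝ} {L : E} (hf : ∀ t > T, HasDerivAt f (f' t) t)
    (hf' : ∀ t > T, HasDerivAt f' (f'' t) t) (hC : ∀ t > T, ‖f'' t‖ ≤ C)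
    (hL : Tendsto f atTop (𝓝 L)) : Tendsto f' atTop (𝓝 0) := by
  have hC0 : 0 ≤ C := (norm_nonneg _).trans (hC (T + 1) (by linarith))
  have key : ∀ t > T, ∀ h > 0, ‖(f (t + h) - f t) - h • f' t‖ ≤ C * h * h := by
    intro t ht h hh
    have hb : ∀ s ∈ Set.Icc t (t + h), ‖f' s - f' t‖ ≤ C * h := by
      intro s hs
      have := (convex_Icc t (t + h)).norm_image_sub_le_of_norm_hasDerivWithin_le
        (fun x hx => (hf' x (by linarith [hx.1])).hasDerivWithinAt)
        (fun x hx => hC x (by linarith [hx.1])) (Set.left_mem_Icc.2 (by linarith)) hs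
      refine this.trans ?_
      rw [Real.norm_of_nonneg (by linarith [hs.1])]
      exact mul_le_mul_of_nonneg_left (by linarith [hs.2]) hC0
    have := (convex_Icc t (t + h)).norm_image_sub_le_of_norm_hasDerivWithin_le
        (f := fun s => f s - s • f' t)
        (fun x hx => ((hf x (by linarith [hx.1])).sub
          ((hasDerivAt_id x).smul_const (f' t))).hasDerivWithinAt)
        (fun x hx => by simpa using hb x hx) (Set.left_mem_Icc.2 (by linarith))
        (Set.right_mem_Icc.2 (by linarith))
    simp only [add_sub_cancel_left, Real.norm_of_nonneg hh.le] at this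
    convert this using 2
    rw [add_smul]; abel
  rw [Metric.tendsto_nhds]
  intro ε hε
  -- A fixed increment, so short that the Taylor remainder `C h²` is below `h ε / 2`; `C + 1` covers
  -- the case `C = 0`.
  set h := ε / (2 * (C + 1)) with hh
  have hpos : 0 < h := by positivity
  have hCh : C * h < ε / 2 := by
    rw [hh]
    have : ε / (2 * (C + 1)) * (C + 1) = ε / 2 := by field_simp
    nlinarith
  have hlim : Tendsto (fun t => f (t + h) - f t) atTop (𝓝 0) := by
    simpa using (hL.comp (tendsto_atTop_add_const_right atTop h tendsto_id)).sub hL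
  filter_upwards [(Metric.tendsto_nhds.1 hlim) (h * (ε / 2)) (by positivity), eventually_gt_atTop T]
    with t h1 h2
  rw [dist_zero_right] at h1 ⊢
  have h3 : ‖h • f' t‖ ≤ ‖f (t + h) - f t‖ + C * h * h := by
    have := norm_sub_norm_le (h • f' t) (f (t + h) - f t)
    have hk := key t h2 h hpos
    rw [norm_sub_rev] at hk
    linarith [key t h2 h hpos]
  rw [norm_smul, Real.norm_of_nonneg hpos.le] at h3
  have : h * ‖f' t‖ < h * ε := by nlinarith
  exact lt_of_mul_lt_mul_left this hpos.le

/-- An antitone function that is bounded below converges at infinity. -/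
theorem AntitoneOn.exists_tendsto_atTop {f : ℝ → ℝ} {T m : ℝ} (hf : AntitoneOn f (Set.Ioi T))
    (hm : ∀ t > T, m ≤ f t) : ∃ L, Tendsto f atTop (𝓝 L) := by
  have hanti : Antitone (fun t => f (max t (T + 1))) := fun s t hst =>
    hf (by simp) (by simp) (max_le_max_right _ hst)
  refine ⟨_, (tendsto_atTop_ciInf hanti ⟨m, ?_⟩).congr' ?_⟩
  · rintro _ ⟨t, rfl⟩
    exact hm _ (by simp)
  · filter_upwards [eventually_ge_atTop (T + 1)] with t ht
    simp [max_eq_left ht]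

/-- A generalized inverse, built by extending a section of `A` onto its range. Since `x - h (A x)`
lies in the kernel, `‖h (A x)‖` bounds the distance from `x` to the kernel. -/
theorem LinearMap.exists_comp_comp_eq {𝕜 E F : Type*} [Field 𝕜] [AddCommGroup E] [Module 𝕜 E]
    [AddCommGroup F] [Module 𝕜 F] (A : E →ₗ[𝕜] F) : ∃ h : F →ₗ[𝕜] E, A ∘ₗ h ∘ₗ A = A := by
  obtain ⟨g, hg⟩ := A.rangeRestrict.exists_rightInverse_of_surjective A.range_rangeRestrict
  obtain ⟨h, hh⟩ := LinearMap.exists_extend g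
  refine ⟨h, LinearMap.ext fun x => ?_⟩
  have h1 : h (A x) = g (A.rangeRestrict x) := by rw [← hh]; rfl
  have h2 := congrArg Subtype.val (LinearMap.congr_fun hg (A.rangeRestrict x))
  simpa [h1] using h2

/-! ### The switching algorithm and its termination -/

namespace PowerSystem

variable {N : Type*} [Fintype N] [DecidableEq N] {𝓛 : N → Type*} [∀ j, Fintype (𝓛 j)]
  {P : PowerSystem N 𝓛}

theorem d_le_beta [Nonempty (Σ j, 𝓛 j)] (P : PowerSystem N 𝓛) (l : Σ j, 𝓛 j) : P.d l ≤ P.beta :=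
  Finset.le_sup' P.d (Finset.mem_univ l)

theorem beta_pos [Nonempty (Σ j, 𝓛 j)] (P : PowerSystem N 𝓛) : 0 < P.beta :=
  (P.d_pos (Classical.arbitrary _)).trans_le (P.d_le_beta _)

theorem K_pos (P : PowerSystem N 𝓛) : 0 < P.K := by
  have := P.lines_connected.nonempty
  exact Finset.sum_pos (fun j _ => P.κ_pos j) Finset.univ_nonempty

namespace AlgParams

variable {a : P.AlgParams}

theorem Admissible.cbar_pos (ha : a.Admissible) (l : Σ j, 𝓛 j) : 0 < a.cbar l :=
  add_pos_of_nonneg_of_pos (P.c_nonneg l) (ha.r_mem l).1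

theorem isBinary_response (a : P.AlgParams) (p : ℝ) : IsBinary (a.response p) := by
  intro l
  unfold response
  split_ifs
  · exact Or.inl rfl
  · exact Or.inr rfl
  · exact P.ρ_binary l

/-- The price at which the load `l` switches. -/
def threshold (a : P.AlgParams) (l : Σ j, 𝓛 j) : ℝ := (2 * P.ρ l - 1) * (a.cbar l / P.d l)

/-- The sign of a threshold reveals the desired state because `c̄ / d > 0`, and its absolute value
reveals the load by `cbar_distinct`. -/
theorem Admissible.threshold_injective (ha : a.Admissible) : Function.Injective a.threshold := by
  intro l m h
  refine ha.cbar_distinct ?_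
  have hl := div_pos (ha.cbar_pos l) (P.d_pos l)
  have hm := div_pos (ha.cbar_pos m) (P.d_pos m)
  simp only [threshold] at h ⊢
  rcases P.ρ_binary l with h1 | h1 <;> rcases P.ρ_binary m with h2 | h2 <;>
    rw [h1, h2] at h <;> linarith

theorem Admissible.response_eq_one (ha : a.Admissible) {p : ℝ} {l : Σ j, 𝓛 j}
    (h : p < a.threshold l) : a.response p l = 1 := by
  have hl := div_pos (ha.cbar_pos l) (P.d_pos l)
  unfold threshold at h
  unfold response
  rcases P.ρ_binary l with h1 | h1 <;> rw [h1] at h ⊢ <;> split_ifs <;> linarith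

theorem Admissible.response_eq_zero (ha : a.Admissible) {p : ℝ} {l : Σ j, 𝓛 j}
    (h : a.threshold l < p) : a.response p l = 0 := by
  have hl := div_pos (ha.cbar_pos l) (P.d_pos l)
  unfold threshold at h
  unfold response
  rcases P.ρ_binary l with h1 | h1 <;> rw [h1] at h ⊢ <;> split_ifs <;> linarith

theorem Admissible.response_antitone (ha : a.Admissible) (l : Σ j, 𝓛 j) :
    Antitone fun p => a.response p l := by
  intro p p' hpp
  rcases hpp.eq_or_lt with rfl | hpp
  · exact le_rfl
  rcases lt_or_ge p (a.threshold l) with h | h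
  · simp only [ha.response_eq_one h]
    rcases a.isBinary_response p' l with h | h <;> rw [h] <;> norm_num
  · simp only [ha.response_eq_zero (h.trans_lt hpp)]
    rcases a.isBinary_response p l with h | h <;> rw [h] <;> norm_num

/-- The uniform power command `p̂ᶜ` at equilibria of the network in which the loads respond to the
price `p`. -/
def power (a : P.AlgParams) (p : ℝ) : ℝ := (P.ell + ∑ l, P.d l * a.response p l) / P.K

theorem Admissible.power_antitone (ha : a.Admissible) : Antitone a.power := fun _ _ h =>
  div_le_div_of_nonneg_right (add_le_add_right (Finset.sum_le_sum fun l _ =>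
    mul_le_mul_of_nonneg_left (ha.response_antitone l h) (P.d_pos l).le) _) P.K_pos.le

theorem response_nonneg (a : P.AlgParams) (p : ℝ) (l : Σ j, 𝓛 j) : 0 ≤ a.response p l := by
  rcases a.isBinary_response p l with h | h <;> rw [h] <;> norm_num

theorem response_le_one (a : P.AlgParams) (p : ℝ) (l : Σ j, 𝓛 j) : a.response p l ≤ 1 := by
  rcases a.isBinary_response p l with h | h <;> rw [h] <;> norm_num

theorem ell_div_K_le_power (a : P.AlgParams) (p : ℝ) : P.ell / P.K ≤ a.power p :=
  div_le_div_of_nonneg_right (le_add_of_nonneg_right (Finset.sum_nonneg fun l _ =>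
    mul_nonneg (P.d_pos l).le (a.response_nonneg p l))) P.K_pos.le

theorem power_le (a : P.AlgParams) (p : ℝ) : a.power p ≤ (P.ell + ∑ l, P.d l) / P.K :=
  div_le_div_of_nonneg_right (add_le_add_right (Finset.sum_le_sum fun l _ =>
    mul_le_of_le_one_right (P.d_pos l).le (a.response_le_one p l)) _) P.K_pos.le

/-- At most one load switches between two prices that are close to each other. -/
theorem Admissible.exists_power_sub_le [Nonempty (Σ j, 𝓛 j)] (ha : a.Admissible) :
    ∃ g > 0, ∀ p p', p ≤ p' → p' - p < g → a.power p - a.power p' ≤ P.beta / P.K := by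
  -- The thresholds are finitely many and distinct, so some `g > 0` is below all their mutual
  -- distances.
  have hev : ∀ᶠ g in 𝓝[>] (0 : ℝ), ∀ l m, l ≠ m → g < |a.threshold l - a.threshold m| := by
    refine eventually_all.2 fun l => eventually_all.2 fun m => ?_
    by_cases h : l = m
    · simp [h]
    · have : 0 < |a.threshold l - a.threshold m| :=
        abs_pos.2 (sub_ne_zero.2 (ha.threshold_injective.ne h))
      filter_upwards [Ioo_mem_nhdsGT this] with g hg _ using hg.2
  obtain ⟨g, hg, hg0⟩ := (hev.and self_mem_nhdsWithin).exists
  refine ⟨g, hg0, fun p p' hpp hlt => ?_⟩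
  have hbet : ∀ l, a.response p l ≠ a.response p' l → p ≤ a.threshold l ∧ a.threshold l ≤ p' := by
    intro l hl
    constructor <;> by_contra! h
    · exact hl (by rw [ha.response_eq_zero h, ha.response_eq_zero (h.trans_le hpp)])
    · exact hl (by rw [ha.response_eq_one h, ha.response_eq_one (hpp.trans_lt h)])
  have hsum : ∑ l, P.d l * a.response p l - ∑ l, P.d l * a.response p' l ≤ P.beta := by
    rw [← Finset.sum_sub_distrib]
    by_cases hex : ∃ l, a.response p l ≠ a.response p' l
    · obtain ⟨l, hl⟩ := hex
      rw [Finset.sum_eq_single l]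
      · have h1 := a.response_le_one p l
        have h2 := a.response_nonneg p' l
        have h3 := P.d_le_beta l
        nlinarith [P.d_pos l]
      · intro m _ hml
        by_contra hm
        have hm' : a.response p m ≠ a.response p' m := fun h => hm (by rw [h, sub_self])
        have h1 := hbet l hl
        have h2 := hbet m hm'
        have := hg m l hml
        have h3 : |a.threshold m - a.threshold l| ≤ p' - p := abs_le.2 ⟨by linarith, by linarith⟩
        linarith
      · simp
    · push Not at hex
      simp [hex, P.beta_pos.le]
  unfold power
  rw [← sub_div]
  exact div_le_div_of_nonneg_right (by linarith) P.K_pos.le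

variable [Nonempty (Σ j, 𝓛 j)]

/-- The price signal that the algorithm tries in the iteration following `v`. -/
def trial (a : P.AlgParams) (v : Vars P) : ℝ := a.μ * v.pmax + (1 - a.μ) * v.pmin

/-- The three possible outcomes of an iteration. -/
theorem Admissible.step_cases (ha : a.Admissible) {v : Vars P} (hv : v.pmin < v.pmax) :
    (a.trial v < a.power (a.trial v) - a.betaBar / P.K ∧ (a.step v).pmin = a.trial v ∧
      (a.step v).pmax = v.pmax ∧ (a.step v).phi = 0) ∨
    (a.power (a.trial v) < a.trial v ∧ (a.step v).pmin = v.pmin ∧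
      (a.step v).pmax = a.trial v ∧ (a.step v).phi = 0) ∨
    (a.power (a.trial v) - a.betaBar / P.K ≤ a.trial v ∧ a.trial v ≤ a.power (a.trial v) ∧
      (a.step v).pmin = v.pmin ∧ (a.step v).pmax = v.pmax ∧ (a.step v).phi = 1) := by
  have hμ := ha.μ_mem
  -- The trial price is strictly inside the bracket, so any update changes the width; hence `phi =
  -- 1` exactly when neither bound moves.
  have h1 : v.pmin < a.trial v := by unfold trial; nlinarith [hμ.1, hμ.2]
  have h2 : a.trial v < v.pmax := by unfold trial; nlinarith [hμ.1, hμ.2]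
  have hb : 0 < a.betaBar / P.K :=
    div_pos (by have := P.beta_pos; have := ha.δ_pos; unfold betaBar; linarith) P.K_pos
  have e1 : (a.step v).pmin = if a.trial v < a.power (a.trial v) - a.betaBar / P.K then a.trial v
    else v.pmin := rfl
  have e2 : (a.step v).pmax = if a.trial v > a.power (a.trial v) then a.trial v
    else v.pmax := rfl
  have e3 : (a.step v).phi =
    if (a.step v).pmax - (a.step v).pmin = v.pmax - v.pmin then 1 else 0 := rfl
  rcases lt_or_ge (a.trial v) (a.power (a.trial v) - a.betaBar / P.K) with h | h
  · left
    rw [if_pos h] at e1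
    rw [if_neg (by linarith)] at e2
    rw [e1, e2, if_neg (by intro h; linarith)] at e3
    exact ⟨h, e1, e2, e3⟩
  rw [if_neg h.not_gt] at e1
  rcases lt_or_ge (a.power (a.trial v)) (a.trial v) with h' | h'
  · right; left
    rw [if_pos h'] at e2
    rw [e1, e2, if_neg (by intro h; linarith)] at e3
    exact ⟨h', e1, e2, e3⟩
  · right; right
    rw [if_neg h'.not_gt] at e2
    rw [e1, e2, if_pos rfl] at e3
    exact ⟨h, h', e1, e2, e3⟩

theorem Admissible.pmin_lt_pmax (ha : a.Admissible) (k : ℕ) :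
    (a.vars k).pmin < (a.vars k).pmax := by
  induction k with
  | zero =>
    have h : P.ell / P.K < (P.ell + ∑ l, P.d l) / P.K :=
      div_lt_div_of_pos_right (lt_add_of_pos_right _
        (Finset.sum_pos (fun l _ => P.d_pos l) Finset.univ_nonempty)) P.K_pos
    exact ha.pmin₀_le.trans_lt (h.trans_le ha.le_pmax₀)
  | succ k ih =>
    have hμ := ha.μ_mem
    have h1 : (a.vars k).pmin < a.trial (a.vars k) := by unfold trial; nlinarith [hμ.1, hμ.2]
    have h2 : a.trial (a.vars k) < (a.vars k).pmax := by unfold trial; nlinarith [hμ.1, hμ.2]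
    rcases ha.step_cases ih with h | h | h <;>
      simp only [vars, h] <;> assumption

/-- Bisection invariant: a bound moves only to a trial price that failed the stopping test on its
side. The initial bounds need not satisfy these inequalities, hence the alternative here and in
`pmax_eq_or`. -/
theorem Admissible.pmin_eq_or (ha : a.Admissible) (k : ℕ) : (a.vars k).pmin = a.pmin₀ ∨
    (a.vars k).pmin < a.power (a.vars k).pmin - a.betaBar / P.K := by
  induction k with
  | zero => exact Or.inl rfl
  | succ k ih =>
    rcases ha.step_cases (ha.pmin_lt_pmax k) with ⟨h, h1, -⟩ | ⟨-, h1, -⟩ | ⟨-, -, h1, -⟩ <;>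
      simp only [vars, h1]
    · exact Or.inr h
    · exact ih
    · exact ih

theorem Admissible.pmax_eq_or (ha : a.Admissible) (k : ℕ) : (a.vars k).pmax = a.pmax₀ ∨
    a.power (a.vars k).pmax < (a.vars k).pmax := by
  induction k with
  | zero => exact Or.inl rfl
  | succ k ih =>
    rcases ha.step_cases (ha.pmin_lt_pmax k) with ⟨-, -, h1, -⟩ | ⟨h, -, h1, -⟩ | ⟨-, -, -, h1, -⟩ <;>
      simp only [vars, h1]
    · exact ih
    · exact Or.inr h
    · exact ih

/-- Raising `pmin` to the trial price multiplies the width by `1 - μ`; lowering `pmax` multiplies it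
by `μ`. -/
theorem Admissible.width_le (ha : a.Admissible) (h0 : ∀ k, (a.vars k).phi ≠ 1) (k : ℕ) :
    (a.vars k).pmax - (a.vars k).pmin ≤ (max a.μ (1 - a.μ)) ^ k * (a.pmax₀ - a.pmin₀) := by
  induction k with
  | zero => simp [vars, init]
  | succ k ih =>
    have hw := ha.pmin_lt_pmax k
    have hμ := ha.μ_mem
    have hm : 0 ≤ max a.μ (1 - a.μ) := hμ.1.le.trans (le_max_left _ _)
    rw [pow_succ', mul_assoc]
    refine le_trans ?_ (mul_le_mul_of_nonneg_left ih hm)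
    have hm1 := mul_le_mul_of_nonneg_right (le_max_left a.μ (1 - a.μ)) (sub_pos.2 hw).le
    have hm2 := mul_le_mul_of_nonneg_right (le_max_right a.μ (1 - a.μ)) (sub_pos.2 hw).le
    rcases ha.step_cases hw with h | h | h
    · simp only [vars, h]
      unfold trial; linarith
    · simp only [vars, h]
      unfold trial; linarith
    · exact absurd h.2.2.2.2 (h0 (k + 1))

/-- The algorithm terminates. -/
theorem Admissible.exists_phi_eq_one (ha : a.Admissible) : ∃ k, (a.vars k).phi = 1 := by
  by_contra! h0
  have hK := P.K_pos
  have hβ := P.beta_pos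
  have hδ := ha.δ_pos
  have hμ := ha.μ_mem
  have hlim : Tendsto (fun k => (a.vars k).pmax - (a.vars k).pmin) atTop (𝓝 0) := by
    refine squeeze_zero (fun k => (sub_pos.2 (ha.pmin_lt_pmax k)).le) (ha.width_le h0) ?_
    simpa using (tendsto_pow_atTop_nhds_zero_of_lt_one (r := max a.μ (1 - a.μ))
      (hμ.1.le.trans (le_max_left _ _)) (max_lt hμ.2 (by linarith [hμ.1]))).mul_const
      (a.pmax₀ - a.pmin₀)
  have hsmall : ∀ e > 0, ∀ᶠ k in atTop, (a.vars k).pmax - (a.vars k).pmin < e := fun e he =>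
    hlim.eventually (gt_mem_nhds he)
  obtain ⟨g, hg, hgap⟩ := ha.exists_power_sub_le
  have hbar : a.betaBar / P.K = P.beta / P.K + a.δ / 2 / P.K := by unfold betaBar; ring
  have hb0 : 0 < P.beta / P.K := by positivity
  have hd0 : 0 < a.δ / 2 / P.K := by positivity
  have hw0 : 0 < a.pmax₀ - a.pmin₀ := sub_pos.2 (ha.pmin_lt_pmax 0)
  -- If `pmin` never moved, then `pmax` would have moved and would approach `pmin₀ ≤ ℓ / K`. But
  -- `power pmax < pmax`, while `power ≥ ℓ / K` everywhere and, in the second case of `range_broad`,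
  -- `power ≥ (ℓ + d l) / K` below `p`.
  have hlow : ∀ᶠ k in atTop, (a.vars k).pmin ≠ a.pmin₀ := by
    rcases ha.range_broad with h | ⟨p, hp, l, hl⟩
    · filter_upwards [hsmall _ (sub_pos.2 h), hsmall _ hw0] with k h1 h2 h3
      rcases ha.pmax_eq_or k with h4 | h4
      · rw [h3, h4] at h2
        exact h2.false
      · linarith [a.ell_div_K_le_power (a.vars k).pmax]
    · have hdl : 0 < P.d l / P.K := div_pos (P.d_pos l) hK
      filter_upwards [hsmall _ (sub_pos.2 hp), hsmall _ hw0, hsmall _ hdl] with k h1 h2 h5 h3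
      rcases ha.pmax_eq_or k with h4 | h4
      · rw [h3, h4] at h2
        exact h2.false
      · have h6 : a.power p ≤ a.power (a.vars k).pmax :=
          ha.power_antitone (by linarith [ha.pmin₀_le])
        have h7 : P.ell / P.K + P.d l / P.K ≤ a.power p := by
          rw [← add_div]
          refine div_le_div_of_nonneg_right (add_le_add_right ?_ _) hK.le
          have := Finset.single_le_sum (f := fun l => P.d l * a.response p l)
            (fun m _ => mul_nonneg (P.d_pos m).le (a.response_nonneg p m)) (Finset.mem_univ l)
          simpa [hl] using this
        linarith [ha.pmin₀_le]
  obtain ⟨k, h1, h2, h3, h4⟩ := ((hsmall g hg).and ((hsmall _ hd0).and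
    ((hsmall _ hb0).and hlow))).exists
  have h5 := (ha.pmin_eq_or k).resolve_left h4
  -- If `pmax` is still `pmax₀`, it bounds every value of `power`, so the invariant at `pmin` makes
  -- the width exceed `β̄ / K`. Otherwise both invariants give a drop of `power` above `β̄ / K`
  -- minus the width, which exceeds `β / K` thanks to the margin `δ / 2` in `β̄`.
  rcases ha.pmax_eq_or k with h6 | h6
  · have := (a.power_le (a.vars k).pmin).trans ha.le_pmax₀
    linarith
  · have := hgap _ _ (ha.pmin_lt_pmax k).le h1
    linarith

/-- The final iteration of the algorithm. -/
theorem Admissible.exists_final (ha : a.Admissible) : ∃ k p, a.Executed k ∧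
    (a.vars k).phi = 1 ∧ a.output k = a.response p ∧ a.power p - a.betaBar / P.K ≤ p ∧
    p ≤ a.power p := by
  classical
  have hex := ha.exists_phi_eq_one
  have hspec := Nat.find_spec hex
  obtain ⟨k, hk⟩ : ∃ k, Nat.find hex = k + 1 := by
    refine Nat.exists_eq_succ_of_ne_zero fun h => ?_
    rw [h] at hspec
    simp [vars, init] at hspec
  rw [hk] at hspec
  have hmin : ∀ m < k + 1, (a.vars m).phi = 0 := by
    intro m hm
    have h1 : (a.vars m).phi ≠ 1 := Nat.find_min hex (hk ▸ hm)
    cases m with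
    | zero => rfl
    | succ m =>
      rcases ha.step_cases (ha.pmin_lt_pmax m) with h | h | h
      · exact h.2.2.2
      · exact h.2.2.2
      · exact absurd h.2.2.2.2 h1
  refine ⟨k + 1, a.trial (a.vars k), ⟨by omega, hmin⟩, hspec, ?_, ?_⟩
  · funext l
    simp only [output, hspec, if_true]
    rfl
  · have hspec' : (a.step (a.vars k)).phi = 1 := hspec
    rcases ha.step_cases (ha.pmin_lt_pmax k) with h | h | h
    · rw [h.2.2.2] at hspec'; exact absurd hspec' (by norm_num)
    · rw [h.2.2.2] at hspec'; exact absurd hspec' (by norm_num)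
    · exact ⟨h.1, h.2.1⟩

end AlgParams
end PowerSystem

/-! ### Flows on directed graphs -/

/-- The net inflow at the vertices of a flow `f` along the directed edges in `E`. -/
def inflow {N : Type*} [DecidableEq N] (E : Finset (N × N)) : (E → ℝ) →ₗ[ℝ] N → ℝ :=
  Fintype.linearCombination ℝ fun e : E => Pi.single e.1.2 1 - Pi.single e.1.1 1

theorem inflow_apply {N : Type*} [DecidableEq N] (E : Finset (N × N)) (f : E → ℝ) (j : N) :
    inflow E f j = (∑ e : E with e.1.2 = j, f e) - ∑ e : E with e.1.1 = j, f e := by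
  simp [inflow, Fintype.linearCombination_apply, Finset.sum_apply, Pi.single_apply, mul_sub,
    Finset.sum_filter, Finset.sum_sub_distrib, eq_comm]

/-- Summation by parts. It yields conservation of flow for constant `v`, and the cancellation of the
line terms in the energy balance. -/
theorem sum_mul_inflow {N : Type*} [Fintype N] [DecidableEq N] (E : Finset (N × N)) (f : E → ℝ)
    (v : N → ℝ) : ∑ j, v j * inflow E f j = ∑ e, f e * (v e.1.2 - v e.1.1) := by
  simp only [inflow, Fintype.linearCombination_apply, Finset.sum_apply, Pi.smul_apply,
    Pi.sub_apply, smul_eq_mul, Finset.mul_sum]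
  rw [Finset.sum_comm]
  refine Finset.sum_congr rfl fun e _ => ?_
  have (i : N) : ∑ j, v j * (Pi.single i (1 : ℝ) : N → ℝ) j = v i := by
    simp [Pi.single_apply]
  rw [← this e.1.2, ← this e.1.1, ← Finset.sum_sub_distrib, Finset.mul_sum]
  exact Finset.sum_congr rfl fun j _ => by ring

theorem sum_inflow {N : Type*} [Fintype N] [DecidableEq N] (E : Finset (N × N)) (f : E → ℝ) :
    ∑ j, inflow E f j = 0 := by
  simpa using sum_mul_inflow E f fun _ => 1

theorem eq_of_connected_of_edges {N α : Type*} {E : Finset (N × N)}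
    (hE : (SimpleGraph.fromRel fun i j => (i, j) ∈ E).Connected) {v : N → α}
    (hv : ∀ e ∈ E, v e.1 = v e.2) (i j : N) : v i = v j := by
  obtain ⟨w⟩ := hE.preconnected i j
  induction w with
  | nil => rfl
  | cons h _ ih =>
    rw [← ih]
    rcases h with ⟨-, h | h⟩
    · exact hv _ h
    · exact (hv _ h).symm

/-- On a connected graph, every vector with zero sum is the net inflow of some flow. -/
theorem exists_inflow_eq {N : Type*} [Fintype N] [DecidableEq N] {E : Finset (N × N)}
    (hE : (SimpleGraph.fromRel fun i j => (i, j) ∈ E).Connected) {r : N → ℝ}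
    (hr : ∑ j, r j = 0) : ∃ f, inflow E f = r := by
  obtain ⟨i⟩ := hE.nonempty
  change r ∈ LinearMap.range (inflow E)
  set W := LinearMap.range (inflow E)
  -- Modulo the range, unit vectors at the ends of an edge coincide, so by connectedness all do, and
  -- the class of `r` is its sum times a single class.
  have hc : ∀ j, W.mkQ (Pi.single j 1) = W.mkQ (Pi.single i 1) := fun j =>
    eq_of_connected_of_edges hE (v := fun j => W.mkQ (Pi.single j (1 : ℝ))) (fun e he => by
      refine ((Submodule.Quotient.eq W).2 ⟨Pi.single ⟨e, he⟩ 1, ?_⟩).symm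
      simp [inflow]) j i
  have hsum : r = ∑ j, r j • (Pi.single j (1 : ℝ) : N → ℝ) := by
    funext k
    simp [Finset.sum_apply, Pi.single_apply]
  rw [← Submodule.Quotient.mk_eq_zero, ← Submodule.mkQ_apply, hsum, map_sum]
  simp only [map_smul, hc]
  rw [← Finset.sum_smul, hr, zero_smul]

/-! ### Equilibria of the network -/

namespace PowerSystem

variable {N : Type*} [Fintype N] [DecidableEq N] {𝓛 : N → Type*} [∀ j, Fintype (𝓛 j)]

theorem sum_busDemand (P : PowerSystem N 𝓛) (σ : (Σ j, 𝓛 j) → ℝ) :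
    ∑ j, P.busDemand σ j = ∑ l, P.d l * σ l := by
  rw [Fintype.sum_sigma]; rfl

/-- The linear part of the vector field of the closed-loop system. -/
def linearField (P : PowerSystem N 𝓛) : P.State →ₗ[ℝ] P.State where
  toFun x :=
    ( fun e => P.omega x e.1.1 - P.omega x e.1.2,
      fun j => (P.pM x j - P.A j * P.omega x j
        + inflow P.lines (fun e => P.B e * P.eta x e) j) / P.M j,
      fun j => -(P.pM x j + P.κ j * P.omega x j - P.κ j * P.pC x j) / P.γ j,
      fun j => (-P.pM x j + inflow P.commLines (P.psi x) j) / P.τ j,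
      fun e => (P.pC x e.1.1 - P.pC x e.1.2) / P.τc e )
  map_add' x y := by
    have h : (fun e => P.B e * P.eta (x + y) e) =
        (fun e => P.B e * P.eta x e) + fun e => P.B e * P.eta y e := by
      funext e; simp [eta, mul_add]
    have h' : P.psi (x + y) = P.psi x + P.psi y := rfl
    rw [h, h', map_add, map_add]
    ext <;> simp [omega, pM, pC] <;> ring
  map_smul' c x := by
    have h : (fun e => P.B e * P.eta (c • x) e) = c • fun e => P.B e * P.eta x e := by
      funext e; simp [eta, mul_left_comm]
    have h' : P.psi (c • x) = c • P.psi x := rfl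
    rw [h, h', map_smul, map_smul]
    ext <;> simp [omega, pM, pC] <;> ring

/-- Demand and switching states enter the field additively and cancel in differences. -/
theorem field_sub_field (P : PowerSystem N 𝓛) (σ : (Σ j, 𝓛 j) → ℝ) (x y : P.State) :
    P.field σ x - P.field σ y = P.linearField (x - y) := by
  rw [map_sub]
  ext <;> simp [field, linearField, inflow_apply] <;> ring

/-- The steady-state equations of the network. -/
theorem field_eq_zero_iff (P : PowerSystem N 𝓛) (σ : (Σ j, 𝓛 j) → ℝ) (x : P.State) :
    P.field σ x = 0 ↔ (∀ e ∈ P.lines, P.omega x e.1 = P.omega x e.2) ∧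
      (∀ j, P.pM x j - P.pL j - P.A j * P.omega x j - P.busDemand σ j
        + inflow P.lines (fun e => P.B e * P.eta x e) j = 0) ∧
      (∀ j, P.pM x j + P.κ j * P.omega x j - P.κ j * P.pC x j = 0) ∧
      (∀ j, -P.pM x j + P.pL j + P.busDemand σ j + inflow P.commLines (P.psi x) j = 0) ∧
      ∀ e ∈ P.commLines, P.pC x e.1 = P.pC x e.2 := by
  simp only [field, Prod.mk_eq_zero, funext_iff, Pi.zero_apply, div_eq_zero_iff, (P.M_pos _).ne',
    (P.γ_pos _).ne', (P.τ_pos _).ne', (P.τc_pos _).ne', or_false, sub_eq_zero, neg_eq_zero,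
    Subtype.forall, inflow_apply]
  refine and_congr Iff.rfl (and_congr (forall_congr' fun j => ?_)
    (and_congr Iff.rfl (and_congr (forall_congr' fun j => ?_) Iff.rfl)))
  · constructor <;> intro h <;> linarith
  · constructor <;> intro h <;> linarith

/-- The uniform power command at equilibria with switching states `σ`. -/
def equilibriumPower (P : PowerSystem N 𝓛) (σ : (Σ j, 𝓛 j) → ℝ) : ℝ :=
  (P.ell + ∑ l, P.d l * σ l) / P.K

theorem exists_isEquilibrium (P : PowerSystem N 𝓛) {σ : (Σ j, 𝓛 j) → ℝ} (hσ : IsBinary σ) :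
    ∃ x, P.IsEquilibrium (x, σ) := by
  set p := P.equilibriumPower σ
  have hsum : ∑ j, (P.κ j * p - P.pL j - P.busDemand σ j) = 0 := by
    have h : P.K * p = P.ell + ∑ l, P.d l * σ l := mul_div_cancel₀ _ P.K_pos.ne'
    rw [Finset.sum_sub_distrib, Finset.sum_sub_distrib, sum_busDemand, ← Finset.sum_mul]
    unfold ell K at h
    linarith
  obtain ⟨f, hf⟩ := exists_inflow_eq P.commLines_connected hsum
  obtain ⟨g, hg⟩ := exists_inflow_eq P.lines_connected (r := fun j =>
    -(P.κ j * p - P.pL j - P.busDemand σ j)) (by rw [Finset.sum_neg_distrib, hsum, neg_zero])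
  refine ⟨(fun e => g e / P.B e, 0, fun j => P.κ j * p, fun _ => p, f), hσ, ?_⟩
  rw [field_eq_zero_iff]
  have hg' : (fun e => P.B e * (g e / P.B e)) = g := funext fun e =>
    mul_div_cancel₀ _ (P.B_pos e).ne'
  simp only [omega, pM, pC, eta, psi, hg', hf, hg, Pi.zero_apply]
  refine ⟨fun _ _ => trivial, fun j => by ring, fun j => by ring, fun j => by ring, fun _ _ => trivial⟩

/-- At equilibria the frequency is nominal, and power commands and generation are determined by
the switching states. -/
theorem IsEquilibrium.steadyState {P : PowerSystem N 𝓛} {z : P.FullState}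
    (hz : P.IsEquilibrium z) : P.omega z.1 = 0 ∧ (P.pC z.1 = fun _ => P.equilibriumPower z.2) ∧
      P.pM z.1 = fun j => P.κ j * P.equilibriumPower z.2 := by
  obtain ⟨h1, h2, h3, h4, h5⟩ := (P.field_eq_zero_iff _ _).1 hz.2
  obtain ⟨i⟩ := P.lines_connected.nonempty
  have hω := eq_of_connected_of_edges P.lines_connected h1
  have hp := eq_of_connected_of_edges P.commLines_connected h5
  -- Adding the swing and power command balances eliminates generation and demand; the flows cancel
  -- upon summation over the buses.
  have hadd : ∑ j, P.A j * P.omega z.1 j = 0 := by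
    have e : ∀ j, P.A j * P.omega z.1 j = inflow P.lines (fun e => P.B e * P.eta z.1 e) j +
        inflow P.commLines (P.psi z.1) j := fun j => by linarith [h2 j, h4 j]
    rw [Finset.sum_congr rfl fun j _ => e j, Finset.sum_add_distrib, sum_inflow, sum_inflow,
      add_zero]
  have hω0 : P.omega z.1 = 0 := by
    have hA : 0 < ∑ j, P.A j := Finset.sum_pos (fun j _ => P.A_pos j) ⟨i, Finset.mem_univ i⟩
    rw [Finset.sum_congr rfl fun j _ => by rw [hω j i], ← Finset.sum_mul] at hadd
    funext j
    rw [hω j i]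
    exact (mul_eq_zero.1 hadd).resolve_left hA.ne'
  have hM : ∀ j, P.pM z.1 j = P.κ j * P.pC z.1 i := fun j => by
    have := h3 j
    rw [hω0, hp j i, Pi.zero_apply] at this
    linarith
  have hpi : P.pC z.1 i = P.equilibriumPower z.2 := by
    rw [equilibriumPower, eq_div_iff P.K_pos.ne', ← sum_busDemand]
    have : ∑ j, (-P.pM z.1 j + P.pL j + P.busDemand z.2 j
        + inflow P.commLines (P.psi z.1) j) = 0 := Finset.sum_eq_zero fun j _ => h4 j
    rw [Finset.sum_add_distrib, Finset.sum_add_distrib, Finset.sum_add_distrib, sum_inflow,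
      Finset.sum_neg_distrib, Finset.sum_congr rfl fun j _ => hM j, ← Finset.sum_mul] at this
    unfold ell K
    linarith
  refine ⟨hω0, funext fun j => (hp j i).trans hpi, funext fun j => ?_⟩
  rw [hM j, hpi]

end PowerSystem

/-! ### Optimality of the final switching states -/

namespace PowerSystem

variable {N : Type*} [Fintype N] [DecidableEq N] {𝓛 : N → Type*} [∀ j, Fintype (𝓛 j)]
  {P : PowerSystem N 𝓛}

/-- The cost of the on-off loads that are not in their desired state. -/
def loadCost (P : PowerSystem N 𝓛) (σ : (Σ j, 𝓛 j) → ℝ) : ℝ :=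
  ∑ l, if σ l = P.ρ l then 0 else P.c l

theorem cost_eq (P : PowerSystem N 𝓛) (y : (N → ℝ) × ((Σ j, 𝓛 j) → ℝ)) :
    P.cost y = ∑ j, 1 / 2 * P.q j * y.1 j ^ 2 + P.loadCost y.2 := by
  rw [cost, Finset.sum_add_distrib, loadCost, Fintype.sum_sigma]

theorem mem_feasible_iff (P : PowerSystem N 𝓛) (y : (N → ℝ) × ((Σ j, 𝓛 j) → ℝ)) :
    y ∈ P.feasible ↔ ∑ j, y.1 j = P.K * P.equilibriumPower y.2 ∧ IsBinary y.2 := by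
  rw [feasible, Set.mem_ofPred_eq, Finset.sum_add_distrib, sum_busDemand, equilibriumPower,
    mul_div_cancel₀ _ P.K_pos.ne']
  rfl

theorem mem_feasible (P : PowerSystem N 𝓛) {σ : (Σ j, 𝓛 j) → ℝ} (hσ : IsBinary σ) :
    (fun j => P.κ j * P.equilibriumPower σ, σ) ∈ P.feasible := by
  rw [mem_feasible_iff, ← Finset.sum_mul]
  exact ⟨rfl, hσ⟩

theorem cost_equilibrium (hκ : ∀ j, P.κ j = (P.q j)⁻¹) (σ : (Σ j, 𝓛 j) → ℝ) :
    P.cost (fun j => P.κ j * P.equilibriumPower σ, σ) =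
      P.K * P.equilibriumPower σ ^ 2 / 2 + P.loadCost σ := by
  rw [cost_eq]
  congr 1
  rw [K, Finset.sum_mul, Finset.sum_div]
  refine Finset.sum_congr rfl fun j _ => ?_
  have h : P.q j * P.κ j = 1 := by
    rw [hκ j]
    -- The sign of `q j` is not assumed; `q j ≠ 0` because otherwise `κ j = 0⁻¹ = 0`.
    exact mul_inv_cancel₀ fun h => (P.κ_pos j).ne' (by rw [hκ j, h, inv_zero])
  linear_combination (1 / 2 * P.κ j * P.equilibriumPower σ ^ 2) * h

/-- Weak duality for the generation cost, with the price `p` as multiplier. -/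
theorem le_cost_of_mem_feasible (hκ : ∀ j, P.κ j = (P.q j)⁻¹)
    {y : (N → ℝ) × ((Σ j, 𝓛 j) → ℝ)} (hy : y ∈ P.feasible) (p : ℝ) :
    P.K * (p * P.equilibriumPower y.2 - p ^ 2 / 2) + P.loadCost y.2 ≤ P.cost y := by
  rw [cost_eq]
  refine add_le_add_left ?_ _
  have h := ((P.mem_feasible_iff y).1 hy).1
  have h1 : P.K * (p * P.equilibriumPower y.2 - p ^ 2 / 2) =
      ∑ j, (p * y.1 j - P.κ j * (p ^ 2 / 2)) := by
    rw [Finset.sum_sub_distrib, ← Finset.mul_sum, ← Finset.sum_mul, h]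
    unfold K
    ring
  rw [h1]
  refine Finset.sum_le_sum fun j _ => ?_
  have hk := P.κ_pos j
  have hq : P.q j = (P.κ j)⁻¹ := by rw [hκ j, inv_inv]
  have h2 : 1 / 2 * P.q j * y.1 j ^ 2 - (p * y.1 j - P.κ j * (p ^ 2 / 2)) =
      (y.1 j - P.κ j * p) ^ 2 / (2 * P.κ j) := by
    rw [hq]
    field_simp
    ring
  have : 0 ≤ (y.1 j - P.κ j * p) ^ 2 / (2 * P.κ j) := by positivity
  linarith

/-- For fixed switching states, weak duality at the price `equilibriumPower` is attained by the
equilibrium generation, so only finitely many candidates remain. -/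
theorem exists_isLeast_cost (hκ : ∀ j, P.κ j = (P.q j)⁻¹) :
    ∃ m, IsLeast (P.cost '' P.feasible) m := by
  have hfin : {σ : (Σ j, 𝓛 j) → ℝ | IsBinary σ}.Finite := by
    refine (Set.Finite.pi' (t := fun _ : Σ j, 𝓛 j => ({0, 1} : Set ℝ))
      fun _ => Set.toFinite _).subset fun σ hσ l => ?_
    simpa using hσ l
  obtain ⟨σ, hσ, hmin⟩ := Set.exists_min_image _
    (fun σ => P.cost (fun j => P.κ j * P.equilibriumPower σ, σ)) hfin
    ⟨fun _ => 0, fun _ => Or.inl rfl⟩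
  refine ⟨_, ⟨_, P.mem_feasible hσ, rfl⟩, ?_⟩
  rintro _ ⟨y, hy, rfl⟩
  refine (hmin y.2 ((P.mem_feasible_iff y).1 hy).2).trans ?_
  rw [cost_equilibrium hκ]
  have := le_cost_of_mem_feasible hκ hy (P.equilibriumPower y.2)
  linarith

/-- The response to a price nearly minimizes the price of the demand plus the cost of the
loads. -/
theorem AlgParams.Admissible.loadCost_response_le {a : P.AlgParams} (ha : a.Admissible) (p : ℝ)
    {σ : (Σ j, 𝓛 j) → ℝ} (hσ : IsBinary σ) :
    P.K * (p * P.equilibriumPower (a.response p)) + P.loadCost (a.response p) ≤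
      P.K * (p * P.equilibriumPower σ) + P.loadCost σ + ∑ l, a.r l := by
  -- The priced problem separates over the loads, and each response is optimal for the cost `c̄`,
  -- hence optimal up to `r` for the cost `c`.
  have h : ∀ σ, P.K * (p * P.equilibriumPower σ) + P.loadCost σ =
      p * P.ell + ∑ l, (p * (P.d l * σ l) + if σ l = P.ρ l then 0 else P.c l) := fun σ => by
    rw [mul_left_comm, equilibriumPower, mul_div_cancel₀ _ P.K_pos.ne', Finset.sum_add_distrib,
      ← Finset.mul_sum, loadCost]
    ring
  rw [h, h, add_assoc, ← Finset.sum_add_distrib]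
  refine add_le_add_right (Finset.sum_le_sum fun l _ => ?_) _
  have hd := P.d_pos l
  have hr := (ha.r_mem l).1
  have hc := P.c_nonneg l
  have hcb : a.cbar l / P.d l * P.d l = P.c l + a.r l := div_mul_cancel₀ _ hd.ne'
  have hneg : -(a.cbar l / P.d l) * P.d l = -(P.c l + a.r l) := by rw [neg_mul, hcb]
  by_cases h1 : p > a.cbar l / P.d l
  · have hp : P.c l + a.r l < p * P.d l := hcb ▸ mul_lt_mul_of_pos_right h1 hd
    simp only [AlgParams.response, h1, if_true]
    rcases hσ l with h2 | h2 <;> rcases P.ρ_binary l with h3 | h3 <;> simp [h2, h3] <;> linarith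
  by_cases h2 : p < -(a.cbar l / P.d l)
  · have hp : p * P.d l < -(P.c l + a.r l) := hneg ▸ mul_lt_mul_of_pos_right h2 hd
    simp only [AlgParams.response, h1, h2, if_true, if_false]
    rcases hσ l with h4 | h4 <;> rcases P.ρ_binary l with h3 | h3 <;> simp [h4, h3] <;> linarith
  · have hp : p * P.d l ≤ P.c l + a.r l := hcb ▸ mul_le_mul_of_nonneg_right (not_lt.1 h1) hd.le
    have hp' : -(P.c l + a.r l) ≤ p * P.d l :=
      hneg ▸ mul_le_mul_of_nonneg_right (not_lt.1 h2) hd.le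
    simp only [AlgParams.response, h1, h2, if_false]
    rcases hσ l with h4 | h4 <;> rcases P.ρ_binary l with h3 | h3 <;> simp [h4, h3] <;> linarith

/-- The identity `w² / 2 = (p w - p² / 2) + (w - p)² / 2` compares the equilibrium cost with the
dual bound at `p`. -/
theorem AlgParams.Admissible.isEpsOptimal [Nonempty (Σ j, 𝓛 j)] {a : P.AlgParams}
    (ha : a.Admissible) (hκ : ∀ j, P.κ j = (P.q j)⁻¹) {p : ℝ}
    (h1 : a.power p - a.betaBar / P.K ≤ p) (h2 : p ≤ a.power p)
    (hδ : a.δ ≤ 2 * P.beta ^ 2 / (P.K * Fintype.card (Σ j, 𝓛 j))) :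
    IsEpsOptimal P.cost P.feasible (3 * a.betaHat ^ 2 / (2 * P.K))
      (fun j => P.κ j * P.equilibriumPower (a.response p), a.response p) := by
  refine ⟨P.mem_feasible (a.isBinary_response p), ?_⟩
  obtain ⟨m, hm⟩ := P.exists_isLeast_cost hκ
  refine ⟨m, hm, ?_⟩
  obtain ⟨y, hy, rfl⟩ := hm.1
  have hK := P.K_pos
  have hβ := P.beta_pos
  have hδ0 := ha.δ_pos
  have e1 := le_cost_of_mem_feasible hκ hy p
  have e2 := ha.loadCost_response_le p ((P.mem_feasible_iff y).1 hy).2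
  have hr : ∑ l, a.r l ≤ P.beta ^ 2 / P.K := by
    have hn : (0 : ℝ) < Fintype.card (Σ j, 𝓛 j) := by exact_mod_cast Fintype.card_pos
    calc ∑ l, a.r l ≤ ∑ _l : (Σ j, 𝓛 j), a.δ / 2 := Finset.sum_le_sum fun l _ => (ha.r_mem l).2.le
      _ = Fintype.card (Σ j, 𝓛 j) * (a.δ / 2) := by simp
      _ ≤ Fintype.card (Σ j, 𝓛 j) *
          (2 * P.beta ^ 2 / (P.K * Fintype.card (Σ j, 𝓛 j)) / 2) := by gcongr
      _ = P.beta ^ 2 / P.K := by field_simp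
  rw [cost_equilibrium hκ]
  change P.equilibriumPower (a.response p) - _ ≤ p at h1
  change p ≤ P.equilibriumPower (a.response p) at h2
  set w := P.equilibriumPower (a.response p)
  have hw : P.K * (w - p) ^ 2 / 2 ≤ a.betaHat ^ 2 / (2 * P.K) := by
    have hb : a.betaBar / P.K ≤ a.betaHat / P.K := by
      unfold AlgParams.betaBar AlgParams.betaHat
      gcongr
      linarith
    have : (w - p) ^ 2 ≤ (a.betaHat / P.K) ^ 2 :=
      pow_le_pow_left₀ (by linarith) (by linarith) 2
    calc P.K * (w - p) ^ 2 / 2 ≤ P.K * (a.betaHat / P.K) ^ 2 / 2 := by gcongr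
      _ = a.betaHat ^ 2 / (2 * P.K) := by field_simp
  have hb2 : P.beta ^ 2 / P.K ≤ a.betaHat ^ 2 / P.K := by
    unfold AlgParams.betaHat
    gcongr
    linarith
  have e3 : 3 * a.betaHat ^ 2 / (2 * P.K) = a.betaHat ^ 2 / (2 * P.K) + a.betaHat ^ 2 / P.K := by
    field_simp
    ring
  rw [e3]
  linarith

end PowerSystem

/-! ### Energy decay and convergence to equilibria -/

/-- Barbalat's lemma along the bounded solutions of a linear differential equation. -/
theorem tendsto_apply_zero_of_linear {E F : Type*} [NormedAddCommGroup E] [NormedSpace ℝ E]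
    [NormedAddCommGroup F] [NormedSpace ℝ F] {A : E →L[ℝ] E} (L : E →L[ℝ] F) {y : ℝ → E} {T : ℝ}
    {s : Set E} (hy : ∀ t > T, HasDerivAt y (A (y t)) t) (hs : IsCompact s)
    (hmem : ∀ t > T, y t ∈ s) (hL : Tendsto (fun t => L (y t)) atTop (𝓝 0)) :
    Tendsto (fun t => L (A (y t))) atTop (𝓝 0) := by
  obtain ⟨C, hC⟩ := hs.exists_bound_of_continuousOn (f := fun x => L (A (A x)))
    (by fun_prop : Continuous fun x => L (A (A x))).continuousOn
  exact tendsto_deriv_zero_of_tendsto (fun t ht => L.hasFDerivAt.comp_hasDerivAt t (hy t ht))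
    (fun t ht => (L.comp A).hasFDerivAt.comp_hasDerivAt t (hy t ht))
    (fun t ht => hC _ (hmem t ht)) hL

namespace PowerSystem

variable {N : Type*} [Fintype N] [DecidableEq N] {𝓛 : N → Type*} [∀ j, Fintype (𝓛 j)]

/-- The energy inner product of two states. -/
def energyInner (P : PowerSystem N 𝓛) (x y : P.State) : ℝ :=
  ∑ e, P.B e * (P.eta x e * P.eta y e) + ∑ j, P.M j * (P.omega x j * P.omega y j)
    + ∑ j, P.γ j / P.κ j * (P.pM x j * P.pM y j) + ∑ j, P.τ j * (P.pC x j * P.pC y j)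
    + ∑ e, P.τc e * (P.psi x e * P.psi y e)

/-- The rate at which energy is dissipated. -/
def dissipation (P : PowerSystem N 𝓛) (x : P.State) : ℝ :=
  ∑ j, P.A j * P.omega x j ^ 2 + ∑ j, (P.κ j)⁻¹ * P.pM x j ^ 2

/-- The weights are chosen so that the couplings cancel: the line terms by summation by parts, and
the products of `pM` with `ω` and `pC` because of the weight `γ / κ`. -/
theorem energyInner_linearField (P : PowerSystem N 𝓛) (x : P.State) :
    P.energyInner x (P.linearField x) = -P.dissipation x := by
  have h1 := sum_mul_inflow P.lines (fun e => P.B e * P.eta x e) (P.omega x)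
  have h2 := sum_mul_inflow P.commLines (P.psi x) (P.pC x)
  have e1 : ∑ e, P.B e * (P.eta x e * P.eta (P.linearField x) e) =
      -∑ j, P.omega x j * inflow P.lines (fun e => P.B e * P.eta x e) j := by
    rw [h1, ← Finset.sum_neg_distrib]
    refine Finset.sum_congr rfl fun e _ => ?_
    simp only [eta, linearField, LinearMap.coe_mk, AddHom.coe_mk]
    ring
  have e5 : ∑ e, P.τc e * (P.psi x e * P.psi (P.linearField x) e) =
      -∑ j, P.pC x j * inflow P.commLines (P.psi x) j := by
    rw [h2, ← Finset.sum_neg_distrib]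
    refine Finset.sum_congr rfl fun e _ => ?_
    have := (P.τc_pos e).ne'
    simp only [psi, linearField, LinearMap.coe_mk, AddHom.coe_mk]
    field_simp
    ring
  rw [energyInner, e1, e5, dissipation, ← sub_eq_zero]
  simp only [← Finset.sum_neg_distrib, ← Finset.sum_add_distrib, ← Finset.sum_sub_distrib]
  refine Finset.sum_eq_zero fun j _ => ?_
  have hM := (P.M_pos j).ne'
  have hγ := (P.γ_pos j).ne'
  have hκ := (P.κ_pos j).ne'
  have hτ := (P.τ_pos j).ne'
  simp only [omega, pM, pC, linearField, LinearMap.coe_mk, AddHom.coe_mk]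
  field_simp
  ring

theorem hasDerivAt_component {P : PowerSystem N 𝓛} {y : ℝ → P.State} {y' : P.State} {t : ℝ}
    (h : HasDerivAt y y' t) :
    (∀ e, HasDerivAt (fun s => P.eta (y s) e) (P.eta y' e) t) ∧
    (∀ j, HasDerivAt (fun s => P.omega (y s) j) (P.omega y' j) t) ∧
    (∀ j, HasDerivAt (fun s => P.pM (y s) j) (P.pM y' j) t) ∧
    (∀ j, HasDerivAt (fun s => P.pC (y s) j) (P.pC y' j) t) ∧
    (∀ e, HasDerivAt (fun s => P.psi (y s) e) (P.psi y' e) t) := by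
  have h1 := hasDerivAt_pi.1 h.fst
  have h2 := hasDerivAt_pi.1 h.snd.fst
  have h3 := hasDerivAt_pi.1 h.snd.snd.fst
  have h4 := hasDerivAt_pi.1 h.snd.snd.snd.fst
  have h5 := hasDerivAt_pi.1 h.snd.snd.snd.snd
  exact ⟨h1, h2, h3, h4, h5⟩

theorem hasDerivAt_energy {P : PowerSystem N 𝓛} {y : ℝ → P.State} {y' : P.State} {t : ℝ}
    (h : HasDerivAt y y' t) :
    HasDerivAt (fun s => P.energyInner (y s) (y s)) (2 * P.energyInner (y t) y') t := by
  obtain ⟨h1, h2, h3, h4, h5⟩ := hasDerivAt_component h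
  have := ((((HasDerivAt.fun_sum (u := Finset.univ) fun e _ =>
    ((h1 e).fun_mul (h1 e)).const_mul (P.B e)).fun_add
    (HasDerivAt.fun_sum (u := Finset.univ) fun j _ =>
      ((h2 j).fun_mul (h2 j)).const_mul (P.M j))).fun_add
    (HasDerivAt.fun_sum (u := Finset.univ) fun j _ =>
      ((h3 j).fun_mul (h3 j)).const_mul (P.γ j / P.κ j))).fun_add
    (HasDerivAt.fun_sum (u := Finset.univ) fun j _ =>
      ((h4 j).fun_mul (h4 j)).const_mul (P.τ j))).fun_add
    (HasDerivAt.fun_sum (u := Finset.univ) fun e _ =>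
      ((h5 e).fun_mul (h5 e)).const_mul (P.τc e))
  refine this.congr_deriv ?_
  simp only [energyInner, mul_add, Finset.mul_sum]
  congr 1; congr 1; congr 1; congr 1
  all_goals exact Finset.sum_congr rfl fun _ _ => by ring

theorem hasDerivAt_dissipation {P : PowerSystem N 𝓛} {y : ℝ → P.State} {y' : P.State} {t : ℝ}
    (h : HasDerivAt y y' t) :
    HasDerivAt (fun s => P.dissipation (y s))
      (∑ j, P.A j * (2 * P.omega (y t) j * P.omega y' j)
        + ∑ j, (P.κ j)⁻¹ * (2 * P.pM (y t) j * P.pM y' j)) t := by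
  obtain ⟨-, h2, h3, -, -⟩ := hasDerivAt_component h
  have := (HasDerivAt.fun_sum (u := Finset.univ) fun j _ =>
    ((h2 j).fun_pow 2).const_mul (P.A j)).fun_add
    (HasDerivAt.fun_sum (u := Finset.univ) fun j _ => ((h3 j).fun_pow 2).const_mul (P.κ j)⁻¹)
  refine this.congr_deriv ?_
  simp

theorem sum_mul_self_nonneg {ι : Type*} [Fintype ι] {w : ι → ℝ} (hw : ∀ i, 0 < w i) (f : ι → ℝ) :
    0 ≤ ∑ i, w i * (f i * f i) :=
  Finset.sum_nonneg fun i _ => mul_nonneg (hw i).le (mul_self_nonneg _)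

theorem abs_le_sqrt_of_sum_mul_self_le {ι : Type*} [Fintype ι] {w : ι → ℝ} (hw : ∀ i, 0 < w i)
    {f : ι → ℝ} {c : ℝ} (h : ∑ i, w i * (f i * f i) ≤ c) (i : ι) : |f i| ≤ √(c / w i) := by
  refine Real.abs_le_sqrt ?_
  rw [le_div_iff₀ (hw i)]
  have : w i * (f i * f i) ≤ _ := Finset.single_le_sum (f := fun i => w i * (f i * f i))
    (fun j _ => mul_nonneg (hw j).le (mul_self_nonneg _)) (Finset.mem_univ i)
  nlinarith

/-- Sublevel sets of the energy are bounded. -/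
theorem exists_isCompact_energy_le (P : PowerSystem N 𝓛) (c : ℝ) :
    ∃ s : Set P.State, IsCompact s ∧ ∀ x, P.energyInner x x ≤ c → x ∈ s := by
  set b : P.State := (fun e => √(c / P.B e), fun j => √(c / P.M j),
    fun j => √(c / (P.γ j / P.κ j)), fun j => √(c / P.τ j), fun e => √(c / P.τc e))
  refine ⟨Set.Icc (-b) b, isCompact_Icc, fun x hx => ?_⟩
  have p1 := sum_mul_self_nonneg P.B_pos (P.eta x)
  have p2 := sum_mul_self_nonneg P.M_pos (P.omega x)
  have hγ : ∀ j, 0 < P.γ j / P.κ j := fun j => div_pos (P.γ_pos j) (P.κ_pos j)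
  have p3 := sum_mul_self_nonneg hγ (P.pM x)
  have p4 := sum_mul_self_nonneg P.τ_pos (P.pC x)
  have p5 := sum_mul_self_nonneg P.τc_pos (P.psi x)
  unfold energyInner at hx
  have q1 := fun e => abs_le.1 (abs_le_sqrt_of_sum_mul_self_le P.B_pos
    (by linarith : _ ≤ c) e (f := P.eta x))
  have q2 := fun j => abs_le.1 (abs_le_sqrt_of_sum_mul_self_le P.M_pos
    (by linarith : _ ≤ c) j (f := P.omega x))
  have q3 := fun j => abs_le.1 (abs_le_sqrt_of_sum_mul_self_le hγ
    (by linarith : _ ≤ c) j (f := P.pM x))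
  have q4 := fun j => abs_le.1 (abs_le_sqrt_of_sum_mul_self_le P.τ_pos
    (by linarith : _ ≤ c) j (f := P.pC x))
  have q5 := fun e => abs_le.1 (abs_le_sqrt_of_sum_mul_self_le P.τc_pos
    (by linarith : _ ≤ c) e (f := P.psi x))
  exact ⟨⟨fun e => (q1 e).1, fun j => (q2 j).1, fun j => (q3 j).1, fun j => (q4 j).1,
      fun e => (q5 e).1⟩, ⟨fun e => (q1 e).2, fun j => (q2 j).2, fun j => (q3 j).2,
      fun j => (q4 j).2, fun e => (q5 e).2⟩⟩

theorem tendsto_zero_of_mul_sq_le {f g : ℝ → ℝ} {w : ℝ} (hw : 0 < w)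
    (h : ∀ t, w * f t ^ 2 ≤ g t) (hg : Tendsto g atTop (𝓝 0)) : Tendsto f atTop (𝓝 0) := by
  refine squeeze_zero_norm (fun t => Real.abs_le_sqrt (y := g t / w) ?_) ?_
  · rw [le_div_iff₀ hw]
    linarith [h t]
  · simpa using (hg.div_const w).sqrt

/-- Along solutions of the linear part of the system, the velocity tends to zero. -/
theorem tendsto_linearField_zero (P : PowerSystem N 𝓛) {y : ℝ → P.State} {T : ℝ}
    (hy : ∀ t > T, HasDerivAt y (P.linearField (y t)) t) :
    Tendsto (fun t => P.linearField (y t)) atTop (𝓝 0) := by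
  set A : P.State →L[ℝ] P.State := LinearMap.toContinuousLinearMap P.linearField
  have hVd : ∀ t > T, HasDerivAt (fun s => P.energyInner (y s) (y s))
      (-2 * P.dissipation (y t)) t := fun t ht => by
    refine (hasDerivAt_energy (hy t ht)).congr_deriv ?_
    rw [energyInner_linearField]
    ring
  have hdiss : ∀ x : P.State, 0 ≤ P.dissipation x := fun x =>
    add_nonneg (Finset.sum_nonneg fun j _ => mul_nonneg (P.A_pos j).le (sq_nonneg _))
      (Finset.sum_nonneg fun j _ => mul_nonneg (inv_nonneg.2 (P.κ_pos j).le) (sq_nonneg _))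
  have hanti : AntitoneOn (fun s => P.energyInner (y s) (y s)) (Set.Ioi T) := by
    refine antitoneOn_of_deriv_nonpos (convex_Ioi T)
      (fun t ht => (hVd t ht).continuousAt.continuousWithinAt) ?_ ?_ <;>
      rw [interior_Ioi]
    · exact fun t ht => (hVd t ht).differentiableAt.differentiableWithinAt
    · intro t ht
      rw [(hVd t ht).deriv]
      linarith [hdiss (y t)]
  have hnonneg : ∀ x : P.State, 0 ≤ P.energyInner x x := fun x => by
    have p1 := sum_mul_self_nonneg P.B_pos (P.eta x)
    have p2 := sum_mul_self_nonneg P.M_pos (P.omega x)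
    have p3 := sum_mul_self_nonneg (fun j => div_pos (P.γ_pos j) (P.κ_pos j)) (P.pM x)
    have p4 := sum_mul_self_nonneg P.τ_pos (P.pC x)
    have p5 := sum_mul_self_nonneg P.τc_pos (P.psi x)
    unfold energyInner
    linarith
  obtain ⟨L, hL⟩ := hanti.exists_tendsto_atTop fun t _ => hnonneg (y t)
  obtain ⟨s, hs, hsub⟩ := P.exists_isCompact_energy_le
    (P.energyInner (y (T + 1)) (y (T + 1)))
  have hT : ∀ t > T + 1, T < t := fun t ht => (lt_add_one T).trans ht
  have hmem : ∀ t > T + 1, y t ∈ s := fun t ht =>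
    hsub _ (hanti (Set.mem_Ioi.2 (lt_add_one T)) (hT t ht) (le_of_lt ht))
  have hstep : ∀ φ : P.State →ₗ[ℝ] ℝ, Tendsto (fun t => φ (y t)) atTop (𝓝 0) →
      Tendsto (fun t => φ (P.linearField (y t))) atTop (𝓝 0) := fun φ =>
    tendsto_apply_zero_of_linear (A := A) (LinearMap.toContinuousLinearMap φ)
      (fun t ht => hy t (hT t ht)) hs hmem
  have hQ : Tendsto (fun t => P.dissipation (y t)) atTop (𝓝 0) := by
    have hcA : Continuous fun x => P.linearField x := A.continuous
    -- The second derivative of the energy as a function of the state, bounded on the compact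
    -- sublevel set.
    have hc : Continuous fun x : P.State => -2 *
        (∑ j, P.A j * (2 * P.omega x j * P.omega (P.linearField x) j)
          + ∑ j, (P.κ j)⁻¹ * (2 * P.pM x j * P.pM (P.linearField x) j)) := by
      have c1 : ∀ j, Continuous fun x : P.State => P.omega x j := fun j =>
        (continuous_apply j).comp continuous_snd.fst
      have c2 : ∀ j, Continuous fun x : P.State => P.pM x j := fun j =>
        (continuous_apply j).comp continuous_snd.snd.fst
      exact ((continuous_finsetSum _ fun j _ => ((continuous_const.mul (c1 j)).mul
        ((c1 j).comp hcA)).const_mul _).add (continuous_finsetSum _ fun j _ =>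
          ((continuous_const.mul (c2 j)).mul ((c2 j).comp hcA)).const_mul _)).const_mul _
    obtain ⟨C, hC⟩ := hs.exists_bound_of_continuousOn hc.continuousOn
    have := tendsto_deriv_zero_of_tendsto (fun t ht => hVd t (hT t ht))
      (fun t ht => (hasDerivAt_dissipation (hy t (hT t ht))).const_mul (-2))
      (fun t ht => hC _ (hmem t ht)) hL
    simpa [← mul_assoc] using this.const_mul (-1 / 2 : ℝ)
  have hω : ∀ j, Tendsto (fun t => P.omega (y t) j) atTop (𝓝 0) := fun j => by
    refine tendsto_zero_of_mul_sq_le (P.A_pos j) (fun t => ?_) hQ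
    refine le_add_of_le_of_nonneg (Finset.single_le_sum
      (f := fun j => P.A j * P.omega (y t) j ^ 2)
      (fun j _ => mul_nonneg (P.A_pos j).le (sq_nonneg _)) (Finset.mem_univ j)) ?_
    exact Finset.sum_nonneg fun j _ => mul_nonneg (inv_nonneg.2 (P.κ_pos j).le) (sq_nonneg _)
  have hM : ∀ j, Tendsto (fun t => P.pM (y t) j) atTop (𝓝 0) := fun j => by
    refine tendsto_zero_of_mul_sq_le (inv_pos.2 (P.κ_pos j)) (fun t => ?_) hQ
    refine le_add_of_nonneg_of_le ?_ (Finset.single_le_sum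
      (f := fun j => (P.κ j)⁻¹ * P.pM (y t) j ^ 2)
      (fun j _ => mul_nonneg (inv_nonneg.2 (P.κ_pos j).le) (sq_nonneg _)) (Finset.mem_univ j))
    exact Finset.sum_nonneg fun j _ => mul_nonneg (P.A_pos j).le (sq_nonneg _)
  let πω (j : N) : P.State →ₗ[ℝ] ℝ := LinearMap.proj j ∘ₗ LinearMap.fst ℝ _ _ ∘ₗ LinearMap.snd ℝ _ _
  let πM (j : N) : P.State →ₗ[ℝ] ℝ :=
    LinearMap.proj j ∘ₗ LinearMap.fst ℝ _ _ ∘ₗ LinearMap.snd ℝ _ _ ∘ₗ LinearMap.snd ℝ _ _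
  let πC (j : N) : P.State →ₗ[ℝ] ℝ := LinearMap.proj j ∘ₗ LinearMap.fst ℝ _ _ ∘ₗ
    LinearMap.snd ℝ _ _ ∘ₗ LinearMap.snd ℝ _ _ ∘ₗ LinearMap.snd ℝ _ _
  have hω' : ∀ j, Tendsto (fun t => P.omega (P.linearField (y t)) j) atTop (𝓝 0) := fun j =>
    hstep (πω j) (hω j)
  have hM' : ∀ j, Tendsto (fun t => P.pM (P.linearField (y t)) j) atTop (𝓝 0) := fun j =>
    hstep (πM j) (hM j)
  have hC : ∀ j, Tendsto (fun t => P.pC (y t) j) atTop (𝓝 0) := fun j => by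
    -- The generation equation solved for `pC`: everything on its right side, including the
    -- derivative of `pM`, is already known to vanish in the limit.
    have h : ∀ t, P.pC (y t) j = (P.γ j * P.pM (P.linearField (y t)) j + P.pM (y t) j
        + P.κ j * P.omega (y t) j) / P.κ j := fun t => by
      have hγ := (P.γ_pos j).ne'
      have hκ := (P.κ_pos j).ne'
      have e : P.pM (P.linearField (y t)) j =
        -(P.pM (y t) j + P.κ j * P.omega (y t) j - P.κ j * P.pC (y t) j) / P.γ j := rfl
      rw [e]
      field_simp
      ring
    simp only [h]
    simpa using ((((hM' j).const_mul (P.γ j)).add (hM j)).add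
      ((hω j).const_mul (P.κ j))).div_const (P.κ j)
  have hC' : ∀ j, Tendsto (fun t => P.pC (P.linearField (y t)) j) atTop (𝓝 0) := fun j =>
    hstep (πC j) (hC j)
  have hη' : ∀ e, Tendsto (fun t => P.eta (P.linearField (y t)) e) atTop (𝓝 0) := fun e => by
    have := (hω e.1.1).sub (hω e.1.2)
    rwa [sub_zero] at this
  have hψ' : ∀ e, Tendsto (fun t => P.psi (P.linearField (y t)) e) atTop (𝓝 0) := fun e => by
    have := ((hC e.1.1).sub (hC e.1.2)).div_const (P.τc e)
    rwa [sub_zero, zero_div] at this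
  exact (tendsto_pi_nhds.2 hη').prodMk_nhds ((tendsto_pi_nhds.2 hω').prodMk_nhds
    ((tendsto_pi_nhds.2 hM').prodMk_nhds ((tendsto_pi_nhds.2 hC').prodMk_nhds
      (tendsto_pi_nhds.2 hψ'))))

/-- With constant switching states, solutions converge to the set of equilibria. -/
theorem tendsto_infDist_equilibria (P : PowerSystem N 𝓛) {σ : (Σ j, 𝓛 j) → ℝ}
    (hσ : IsBinary σ) {z : ℝ → P.FullState} {T : ℝ} (hz : ∀ t > T, (z t).2 = σ)
    (hx : ∀ t > T, HasDerivAt (fun s => (z s).1) (P.field σ (z t).1) t) :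
    Tendsto (fun t => Metric.infDist (z t) {w | P.IsEquilibrium w ∧ w.2 = σ}) atTop (𝓝 0) := by
  obtain ⟨x₀, -, hx₀⟩ := P.exists_isEquilibrium hσ
  have hf : ∀ x, P.field σ x = P.linearField (x - x₀) := fun x => by
    rw [← field_sub_field P σ, hx₀, sub_zero]
  obtain ⟨h, hh⟩ := P.linearField.exists_comp_comp_eq
  have hlim := P.tendsto_linearField_zero (y := fun s => (z s).1 - x₀) (T := T) fun t ht => by
    rw [← hf]
    exact (hx t ht).sub_const x₀
  have hcont : Continuous h := (LinearMap.toContinuousLinearMap h).continuous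
  have hlim' : Tendsto (fun t => ‖h (P.linearField ((z t).1 - x₀))‖) atTop (𝓝 0) := by
    simpa using ((hcont.tendsto 0).comp hlim).norm
  refine squeeze_zero' (Eventually.of_forall fun _ => Metric.infDist_nonneg) ?_ hlim'
  filter_upwards [eventually_gt_atTop T] with t ht
  -- The correction `v` has the same image under `linearField` as `x - x₀`, so `x - v` is an
  -- equilibrium at distance `‖v‖`.
  set v := h (P.linearField ((z t).1 - x₀)) with hv
  have hmem : ((z t).1 - v, σ) ∈ {w : P.FullState | P.IsEquilibrium w ∧ w.2 = σ} := by
    refine ⟨⟨hσ, ?_⟩, rfl⟩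
    have := LinearMap.congr_fun hh ((z t).1 - x₀)
    simp only [LinearMap.comp_apply] at this
    rw [hf, sub_right_comm, map_sub, hv, this, sub_self]
  refine (Metric.infDist_le_dist_of_mem hmem).trans ?_
  rw [Prod.dist_eq, hz t ht, dist_self, max_eq_left dist_nonneg, dist_eq_norm, sub_sub_cancel]

/-- After the last switch, solutions are continuously differentiable. -/
theorem IsCaratheodorySolution.hasDerivAt {P : PowerSystem N 𝓛} {σ : ℝ → (Σ j, 𝓛 j) → ℝ}
    {x : ℝ → P.State} (hx : P.IsCaratheodorySolution σ x) {σ' : (Σ j, 𝓛 j) → ℝ} {T : ℝ}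
    (hT : 0 ≤ T) (hσ : ∀ s, T ≤ s → σ s = σ') {t : ℝ} (ht : T < t) :
    HasDerivAt x (P.field σ' (x t)) t := by
  have hac : AbsolutelyContinuousOnInterval x T (t + 1) :=
    (hx.1 (t + 1) (by linarith)).mono (by
      rw [Set.uIcc_of_le (by linarith), Set.uIcc_of_le (by linarith)]
      exact Set.Icc_subset_Icc_left hT)
  have hfc : Continuous (P.field σ') := by
    have h : P.field σ' = fun x => P.linearField x + P.field σ' 0 := funext fun x => by
      rw [← sub_eq_iff_eq_add, field_sub_field, sub_zero]
    rw [h]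
    exact (LinearMap.toContinuousLinearMap P.linearField).continuous.add continuous_const
  refine hac.hasDerivAt_of_ae (g := fun s => P.field σ' (x s)) (by linarith) ?_ ?_
    ⟨ht, lt_add_one t⟩
  · have := hac.continuousOn
    rw [Set.uIcc_of_le (by linarith)] at this
    exact hfc.comp_continuousOn this
  · filter_upwards [(ae_restrict_iff' measurableSet_Ici).1 hx.2] with s hs hmem
    rw [← hσ s hmem.1]
    exact hs (hT.trans hmem.1)

end PowerSystem

theorem theorem3 {N : Type*} [Fintype N] [DecidableEq N] {𝓛 : N → Type*} [∀ j, Fintype (𝓛 j)]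
    [Nonempty (Σ j, 𝓛 j)] (P : PowerSystem N 𝓛) (hκ : ∀ j, P.κ j = (P.q j)⁻¹) :
    ∃ δ₀ : ℝ, 0 < δ₀ ∧ ∀ a : P.AlgParams, a.Admissible →
      ∃ S : Set P.FullState, S.Nonempty ∧
        (∀ z ∈ S, P.IsEquilibrium z ∧ P.omega z.1 = 0 ∧ (∃ p : ℝ, P.pC z.1 = fun _ => p) ∧
          (a.δ ≤ δ₀ →
            IsEpsOptimal P.cost P.feasible (3 * a.betaHat ^ 2 / (2 * P.K)) (P.pM z.1, z.2))) ∧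
        ∀ t : ℕ → ℝ, 0 ≤ t 1 → (∀ k, 1 ≤ k → t k ≤ t (k + 1)) →
          ∀ z : ℝ → P.FullState, P.IsSolution a t z →
            Tendsto (fun s => Metric.infDist (z s) S) atTop (𝓝 0) := by
  have hK := P.K_pos
  have hβ := P.beta_pos
  have hn : (0 : ℝ) < Fintype.card (Σ j, 𝓛 j) := by exact_mod_cast Fintype.card_pos
  -- With `n` loads, `∑ r ≤ n δ / 2`; this `δ₀` makes that at most `β² / K`.
  refine ⟨2 * P.beta ^ 2 / (P.K * Fintype.card (Σ j, 𝓛 j)), by positivity, fun a ha => ?_⟩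
  obtain ⟨k, p, hk, hphi, hout, h1, h2⟩ := ha.exists_final
  have hbin := a.isBinary_response p
  refine ⟨{w | P.IsEquilibrium w ∧ w.2 = a.response p}, ?_, ?_, ?_⟩
  · obtain ⟨x, hx⟩ := P.exists_isEquilibrium hbin
    exact ⟨(x, _), hx, rfl⟩
  · rintro ⟨x, σ⟩ ⟨hz, rfl : σ = _⟩
    obtain ⟨hω, hC, hM⟩ := hz.steadyState
    refine ⟨hz, hω, ⟨_, hC⟩, fun hδ => ?_⟩
    rw [hM]
    exact ha.isEpsOptimal hκ h1 h2 hδ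
  · rintro t ht0 ht z ⟨hsw, hcar⟩
    have htk : ∀ m, 1 ≤ m → 0 ≤ t m := fun m hm =>
      Nat.le_induction ht0 (fun m hm ih => ih.trans (ht m hm)) m hm
    have hσ : ∀ s, t k ≤ s → (z s).2 = a.response p := fun s hs =>
      (hsw.2.2 k hk s hs (Or.inl hphi)).trans hout
    exact P.tendsto_infDist_equilibria hbin (fun s hs => hσ s (le_of_lt hs))
      fun s hs => hcar.hasDerivAt (htk k hk.1) hσ hs

end
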